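/- Let $N\ge 1$, let $\Omega\subset\mathbb{R}^N$ be a nonempty bounded open set (not necessarily connected), and let $p\in(2,2^*)$, where $2^*:=\frac{2N}{N-2}$ if $N\ge 3$ and $2^*:=\infty$ if $N=1,2$. Let $Q(x):=1$ for $x\in\Omega$ and $Q(x):=-1$ for $x\in\mathbb{R}^N\smallsetminus\Omega$, and for $\varepsilon>0$ put $Q_\varepsilon(x):=Q(x/\varepsilon)$. Let $H^1(\mathbb{R}^N)$ be the Sobolev space of real-valued functions with norm $\|v\|^2=\int_{\mathbb{R}^N}(|\nabla v|^2+v^2)$. A solution of $$-\Delta v+v=Q_\varepsilon(x)|v|^{p-2}v,\qquad v\in H^1(\mathbb{R}^N),\tag{1}$$ is a function $v\in H^1(\mathbb{R}^N)$ such that, for every $w\in H^1(\mathbb{R}^N)$, the function $Q_\varepsilon|v|^{p-2}vw$ is integrable and $$\int_{\mathbb{R}^N}(\nabla v\cdot\nabla w+vw)=\int_{\mathbb{R}^N}Q_\varepsilon|v|^{p-2}vw .$$ Then, for each $\varepsilon>0$, problem (1) has infinitely many solutions; in fact, it has a sequence of solutions that is unbounded in $H^1(\mathbb{R}^N)$.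 -/

import Mathlib

open MeasureTheory
open scoped ContDiff

noncomputable section

namespace SelfFocusing

/-- Euclidean space `ℝ^N`. -/
abbrev Space (N : ℕ) : Type := EuclideanSpace ℝ (Fin N)

/-- `g` is the weak gradient of `u` on `ℝ^N`: `∫ u ∇φ = - ∫ φ g` for every `φ ∈ C_c^∞(ℝ^N)`
(a vector identity, that is, `∫ u ∂ᵢφ = - ∫ φ gᵢ` for all `i`). -/
def IsWeakGradient {N : ℕ} (u : Space N → ℝ) (g : Space N → Space N) : Prop :=
  ∀ φ : Space N → ℝ, ContDiff ℝ ∞ φ → HasCompactSupport φ →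
    ∫ x, u x • gradient φ x = - ∫ x, φ x • g x

theorem continuous_gradient {N : ℕ} {φ : Space N → ℝ} (hφ : ContDiff ℝ ∞ φ) :
    Continuous (gradient φ) :=
  (InnerProductSpace.toDual ℝ (Space N)).symm.continuous.comp (hφ.continuous_fderiv (by simp))

theorem hasCompactSupport_gradient {N : ℕ} {φ : Space N → ℝ} (hφ : HasCompactSupport φ) :
    HasCompactSupport (gradient φ) :=
  (hφ.fderiv ℝ).comp_left (g := (InnerProductSpace.toDual ℝ (Space N)).symm) (map_zero _)

theorem integrable_smul_gradient {N : ℕ} (u : Lp ℝ 2 (volume : Measure (Space N)))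
    {φ : Space N → ℝ} (h1 : ContDiff ℝ ∞ φ) (h2 : HasCompactSupport φ) :
    Integrable (fun x => u x • gradient φ x) :=
  ((Lp.memLp u).locallyIntegrable (by norm_num)).integrable_smul_right_of_hasCompactSupport
    (continuous_gradient h1) (hasCompactSupport_gradient h2)

theorem integrable_test_smul {N : ℕ} (g : Lp (Space N) 2 (volume : Measure (Space N)))
    {φ : Space N → ℝ} (h1 : ContDiff ℝ ∞ φ) (h2 : HasCompactSupport φ) :
    Integrable (fun x => φ x • g x) :=
  ((Lp.memLp g).locallyIntegrable (by norm_num)).integrable_smul_left_of_hasCompactSupport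
    h1.continuous h2

/-- The Sobolev space `H^1(ℝ^N)` of real functions, realised as the space of pairs `(u, ∇u)` where
`u ∈ L^2(ℝ^N)` has a weak gradient `∇u ∈ L^2(ℝ^N; ℝ^N)`. As a subspace of the Hilbert sum
`L^2 ⊕ L^2` it carries the norm `‖u‖² = ∫ u² + ∫ |∇u|²`. An element is determined by `u`
(`H1.ext_fn`). -/
def H1 (N : ℕ) : Submodule ℝ (WithLp 2
    (Lp ℝ 2 (volume : Measure (Space N)) × Lp (Space N) 2 (volume : Measure (Space N)))) where
  carrier := {w | IsWeakGradient w.fst w.snd}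
  zero_mem' := by
    intro φ _ _
    have h1 : (fun x => ((0 : Lp ℝ 2 (volume : Measure (Space N))) x) • gradient φ x)
        =ᵐ[volume] fun _ => 0 := by
      filter_upwards [Lp.coeFn_zero ℝ 2 (volume : Measure (Space N))] with x hx
      rw [hx, Pi.zero_apply]
      simp
    have h2 : (fun x => φ x • (0 : Lp (Space N) 2 (volume : Measure (Space N))) x)
        =ᵐ[volume] fun _ => 0 := by
      filter_upwards [Lp.coeFn_zero (Space N) 2 (volume : Measure (Space N))] with x hx
      rw [hx, Pi.zero_apply]
      simp
    simp only [WithLp.zero_fst, WithLp.zero_snd]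
    rw [integral_congr_ae h1, integral_congr_ae h2]
    simp
  add_mem' := by
    intro v w hv hw φ h1 h2
    have e1 : (fun x => (v.fst + w.fst : Lp ℝ 2 (volume : Measure (Space N))) x • gradient φ x)
        =ᵐ[volume] fun x => v.fst x • gradient φ x + w.fst x • gradient φ x := by
      filter_upwards [Lp.coeFn_add v.fst w.fst] with x hx
      rw [hx, Pi.add_apply, add_smul]
    have e2 : (fun x => φ x • (v.snd + w.snd : Lp (Space N) 2 (volume : Measure (Space N))) x)
        =ᵐ[volume] fun x => φ x • v.snd x + φ x • w.snd x := by
      filter_upwards [Lp.coeFn_add v.snd w.snd] with x hx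
      rw [hx, Pi.add_apply, smul_add]
    simp only [WithLp.add_fst, WithLp.add_snd]
    rw [integral_congr_ae e1, integral_congr_ae e2,
      integral_add (integrable_smul_gradient _ h1 h2) (integrable_smul_gradient _ h1 h2),
      integral_add (integrable_test_smul _ h1 h2) (integrable_test_smul _ h1 h2),
      hv φ h1 h2, hw φ h1 h2, neg_add]
  smul_mem' := by
    intro c v hv φ h1 h2
    have e1 : (fun x => (c • v.fst : Lp ℝ 2 (volume : Measure (Space N))) x • gradient φ x)
        =ᵐ[volume] fun x => c • (v.fst x • gradient φ x) := by
      filter_upwards [Lp.coeFn_smul c v.fst] with x hx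
      simp [hx, mul_smul]
    have e2 : (fun x => φ x • (c • v.snd : Lp (Space N) 2 (volume : Measure (Space N))) x)
        =ᵐ[volume] fun x => c • (φ x • v.snd x) := by
      filter_upwards [Lp.coeFn_smul c v.snd] with x hx
      rw [hx, Pi.smul_apply, smul_comm]
    simp only [WithLp.smul_fst, WithLp.smul_snd]
    rw [integral_congr_ae e1, integral_congr_ae e2, integral_smul, integral_smul,
      hv φ h1 h2, smul_neg]

/-- The function `u` underlying an element of `H^1(ℝ^N)`, as an element of `L^2(ℝ^N)`. -/
def fn {N : ℕ} (v : H1 N) : Lp ℝ 2 (volume : Measure (Space N)) := v.1.fst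

/-- The weak gradient of an element of `H^1(ℝ^N)`. -/
def grad {N : ℕ} (v : H1 N) : Lp (Space N) 2 (volume : Measure (Space N)) := v.1.snd

/-- An element of `H^1(ℝ^N)` is determined by its underlying `L^2` function. -/
theorem H1.ext_fn {N : ℕ} {v w : H1 N} (h : fn v = fn w) : v = w := by
  have hg : grad v = grad w := by
    apply Lp.ext
    have hi := ae_eq_of_integral_contDiff_smul_eq (μ := volume) (f := grad v) (f' := grad w)
      ((Lp.memLp (grad v)).locallyIntegrable (by norm_num))
      ((Lp.memLp (grad w)).locallyIntegrable (by norm_num)) (by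
        intro φ h1 h2
        have hv : ∫ x, fn v x • gradient φ x = - ∫ x, φ x • grad v x := v.2 φ h1 h2
        have hw : ∫ x, fn w x • gradient φ x = - ∫ x, φ x • grad w x := w.2 φ h1 h2
        rw [h, hw] at hv
        exact (neg_injective hv).symm)
    exact hi
  apply Subtype.ext
  exact WithLp.ofLp_injective 2 (Prod.ext h hg)

/-- The norm of the subspace `H1 N` is the standard norm of `H^1(ℝ^N)`. -/
theorem H1.norm_sq_eq {N : ℕ} (v : H1 N) :
    ‖v‖ ^ 2 = ∫ x, (fn v x ^ 2 + ‖grad v x‖ ^ 2) := by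
  have h1 : ‖v‖ ^ 2 = ‖fn v‖ ^ 2 + ‖grad v‖ ^ 2 := WithLp.prod_norm_sq_eq_of_L2 v.1
  have i1 : Integrable (fun x => fn v x ^ 2) := (Lp.memLp (fn v)).integrable_sq
  have i2 : Integrable (fun x => ‖grad v x‖ ^ 2) := (Lp.memLp (grad v)).norm.integrable_sq
  rw [integral_add i1 i2, h1, ← real_inner_self_eq_norm_sq, ← real_inner_self_eq_norm_sq,
    L2.inner_def, L2.inner_def]
  simp only [real_inner_self_eq_norm_sq, Real.norm_eq_abs, sq_abs]

open Classical in
/-- The function `Q`, equal to `1` on `Ω` and to `-1` outside `Ω`. -/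
def Q {N : ℕ} (Ω : Set (Space N)) (x : Space N) : ℝ := if x ∈ Ω then 1 else -1

/-- The rescaled function `Q_ε(x) = Q(x / ε)`. -/
def Qeps {N : ℕ} (Ω : Set (Space N)) (ε : ℝ) (x : Space N) : ℝ := Q Ω (ε⁻¹ • x)

/-- `v ∈ H^1(ℝ^N)` is a (weak) solution of `-Δv + v = Q_ε |v|^{p-2} v`:
for every `w ∈ H^1(ℝ^N)` one has `∫ (∇v · ∇w + v w) = ∫ Q_ε |v|^{p-2} v w`, where the integral on
the right exists (the one on the left always does). -/
def IsSolution {N : ℕ} (Ω : Set (Space N)) (ε p : ℝ) (v : H1 N) : Prop :=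
  ∀ w : H1 N,
    Integrable (fun x => Qeps Ω ε x * |fn v x| ^ (p - 2) * fn v x * fn w x) ∧
    ∫ x, (inner ℝ (grad v x) (grad w x) + fn v x * fn w x) =
      ∫ x, Qeps Ω ε x * |fn v x| ^ (p - 2) * fn v x * fn w x

end SelfFocusing

end

/-!
Put `B = ε • Ω`, and let `T : H¹ → L^p(B)` and `S : H¹ → L^p(Bᶜ)` be the restrictions. Let `g` be
the gradient of `Φ(v) = (‖T v‖^p - ‖S v‖^p) / p`. Since `g` is homogeneous of degree `p - 1 > 1`, a
unit vector `u` with `g u = c u` and `c > 0` yields the solution `c^(-1/(p-2)) u`, so one needs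
arbitrarily small eigenvalues `c > 0`. The number `c_k`, the supremum over all odd maps of the
`k`-sphere into the unit sphere of the minimum of `p Φ` on the image, is such an eigenvalue:

* `c_k > 0`, because the bump functions supported in `B` span an infinite-dimensional space on which
  `S = 0` and `T` is injective;
* `c_k → 0`, because `T` is compact, hence small on a subspace of finite codimension, which every
  odd image of a sphere of large dimension meets by the Borsuk–Ulam theorem;
* the Palais–Smale condition holds at positive levels: along a Palais–Smale sequence the
  `T`-part of `g` converges by compactness, and the `S`-part is monotone.

`T` is compact since on `B` the dyadic averages, which depend on finitely many integrals, converge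
to `v` in `L^p` uniformly for `‖v‖_{H¹} ≤ 1`.
-/

noncomputable section

namespace SelfFocusing

open Filter Topology Metric

/-! ### The Borsuk–Ulam theorem -/

section Chains

variable {V W A : Type*} [AddCommGroup A]

/-- The codimension one faces of an ordered simplex, given by the list of its vertices. -/
def faces : List V → List (List V)
  | [] => []
  | x :: l => l :: (faces l).map (x :: ·)

/-- The standard triangulation of the prism spanned by the images of an ordered simplex under two
maps of its vertices. -/
def prism (g g' : V → W) : List V → List (List W)
  | [] => []
  | x :: l => (g x :: g' x :: l.map g') :: (prism g g' l).map (g x :: ·)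

/-- The value of a cochain on a chain. A chain modulo 2 is encoded as a list of ordered simplices,
repetitions being allowed. -/
def pairing (c : List (List V)) (φ : List V → A) : A := (c.map φ).sum

/-- The simplicial coboundary of a cochain. There are no signs: it is used modulo 2 only. -/
def coboundary (φ : List V → A) (l : List V) : A := pairing (faces l) φ

@[simp]
theorem pairing_nil (φ : List V → A) : pairing [] φ = 0 := rfl

@[simp]
theorem pairing_cons (l : List V) (c : List (List V)) (φ : List V → A) :
    pairing (l :: c) φ = φ l + pairing c φ :=
  List.sum_cons

@[simp]
theorem pairing_append (c d : List (List V)) (φ : List V → A) :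
    pairing (c ++ d) φ = pairing c φ + pairing d φ := by
  simp only [pairing, List.map_append, List.sum_append]

theorem pairing_map (c : List (List V)) (f : List V → List W) (φ : List W → A) :
    pairing (c.map f) φ = pairing c fun l ↦ φ (f l) := by
  simp only [pairing, List.map_map, Function.comp_def]

theorem pairing_flatMap {ι : Type*} (r : List ι) (f : ι → List (List V)) (φ : List V → A) :
    pairing (r.flatMap f) φ = (r.map fun i ↦ pairing (f i) φ).sum := by
  induction r with
  | nil => rfl
  | cons i r ih => rw [List.flatMap_cons, pairing_append, ih, List.map_cons, List.sum_cons]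

theorem pairing_add (c : List (List V)) (φ ψ : List V → A) :
    pairing c (fun l ↦ φ l + ψ l) = pairing c φ + pairing c ψ :=
  List.sum_map_add

theorem pairing_congr {c : List (List V)} {φ ψ : List V → A} (h : ∀ l ∈ c, φ l = ψ l) :
    pairing c φ = pairing c ψ :=
  congrArg List.sum (List.map_congr_left h)

theorem coboundary_nil (φ : List V → A) : coboundary φ [] = 0 := rfl

theorem coboundary_cons (φ : List V → A) (x : V) (l : List V) :
    coboundary φ (x :: l) = φ l + coboundary (fun q ↦ φ (x :: q)) l := by
  rw [coboundary, faces, pairing_cons, pairing_map, coboundary]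

theorem faces_map (f : V → W) (l : List V) : faces (l.map f) = (faces l).map (List.map f) := by
  induction l with
  | nil => rfl
  | cons x l ih => simp only [List.map_cons, faces, ih, List.map_map, Function.comp_def]

theorem coboundary_map (f : V → W) (φ : List W → A) (l : List V) :
    coboundary φ (l.map f) = coboundary (fun q ↦ φ (q.map f)) l := by
  rw [coboundary, faces_map, pairing_map, coboundary]

theorem coboundary_add (φ ψ : List V → A) (l : List V) :
    coboundary (fun q ↦ φ q + ψ q) l = coboundary φ l + coboundary ψ l :=
  pairing_add _ _ _

theorem coboundary_eq_of_perm {φ : List V → A} (hφ : ∀ a b, a.Perm b → φ a = φ b) {l l' : List V}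
    (h : l.Perm l') : coboundary φ l = coboundary φ l' := by
  induction h generalizing φ with
  | nil => rfl
  | cons x h ih =>
    rw [coboundary_cons, coboundary_cons, hφ _ _ h, ih fun a b hab ↦ hφ _ _ (hab.cons x)]
  | swap x y l =>
    have hswap : coboundary (fun q ↦ φ (y :: x :: q)) l = coboundary (fun q ↦ φ (x :: y :: q)) l :=
      pairing_congr fun q _ ↦ hφ _ _ (.swap x y q)
    rw [coboundary_cons, coboundary_cons, coboundary_cons, coboundary_cons, hswap, add_left_comm]
  | trans _ _ ih ih' => exact (ih hφ).trans (ih' hφ)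

theorem sublist_of_mem_faces {l q : List V} (h : q ∈ faces l) : q.Sublist l := by
  induction l generalizing q with
  | nil => exact absurd h List.not_mem_nil
  | cons x l ih =>
    rcases List.mem_cons.1 h with rfl | h
    · exact List.sublist_cons_self _ _
    · obtain ⟨q, hq, rfl⟩ := List.mem_map.1 h
      exact (ih hq).cons_cons x

theorem length_of_mem_prism {g g' : V → W} {l : List V} {q : List W} (h : q ∈ prism g g' l) :
    q.length = l.length + 1 := by
  induction l generalizing q with
  | nil => exact absurd h List.not_mem_nil
  | cons x l ih =>
    rcases List.mem_cons.1 h with rfl | h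
    · simp only [List.length_cons, List.length_map]
    · obtain ⟨q, hq, rfl⟩ := List.mem_map.1 h
      rw [List.length_cons, List.length_cons, ih hq]

theorem exists_eq_or_eq_of_mem_prism {g g' : V → W} {l : List V} {q : List W}
    (h : q ∈ prism g g' l) {y : W} (hy : y ∈ q) : ∃ x ∈ l, y = g x ∨ y = g' x := by
  induction l generalizing q with
  | nil => exact absurd h List.not_mem_nil
  | cons x l ih =>
    rcases List.mem_cons.1 h with rfl | h
    · simp only [List.mem_cons, List.mem_map] at hy
      rcases hy with rfl | rfl | ⟨z, hz, rfl⟩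
      exacts [⟨x, List.mem_cons_self, .inl rfl⟩, ⟨x, List.mem_cons_self, .inr rfl⟩,
        ⟨z, List.mem_cons_of_mem x hz, .inr rfl⟩]
    · obtain ⟨q, hq, rfl⟩ := List.mem_map.1 h
      rcases List.mem_cons.1 hy with rfl | hy
      · exact ⟨x, List.mem_cons_self, .inl rfl⟩
      · obtain ⟨z, hz, hyz⟩ := ih hq hy
        exact ⟨z, List.mem_cons_of_mem x hz, hyz⟩

variable [Module (ZMod 2) A]

/-- The prism operator is a chain homotopy modulo 2. -/
theorem pairing_prism_coboundary (g g' : V → W) (l : List V) (φ : List W → A) :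
    pairing (prism g g' l) (coboundary φ) + coboundary (fun q ↦ pairing (prism g g' q) φ) l =
      φ (l.map g) + φ (l.map g') := by
  induction l generalizing φ with
  | nil => simp [prism, coboundary_nil, ZModModule.add_self]
  | cons x l ih =>
    have hcone := ih fun q ↦ φ (g x :: q)
    simp only [prism, pairing_cons, pairing_map, coboundary_cons, coboundary_map, pairing_add,
      coboundary_add, List.map_cons] at hcone ⊢
    linear_combination (norm := abel) hcone + ZModModule.add_self (φ (g x :: l.map g')) +
      ZModModule.add_self (pairing (prism g g' l) φ) +
      ZModModule.add_self (coboundary (fun q ↦ φ (g x :: g' x :: q.map g')) l)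

theorem pairing_flatMap_prism_coboundary (g g' : V → W) {c : List (List V)}
    (hc : ∀ ψ : List V → A, pairing c (coboundary ψ) = 0) (φ : List W → A) :
    pairing (c.flatMap (prism g g')) (coboundary φ) =
      pairing c (fun l ↦ φ (l.map g)) + pairing c fun l ↦ φ (l.map g') := by
  rw [pairing_flatMap, ← pairing_add,
    ← pairing_congr fun l _ ↦ pairing_prism_coboundary g g' l φ, pairing_add]
  exact (add_zero _).symm.trans (congrArg _ (hc _).symm)

end Chains

section Labels

/-- The `2 × 2` matrices over the field with two elements. -/
abbrev Mat2 := Matrix (Fin 2) (Fin 2) (ZMod 2)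

/-- The matrix of the transposition of the two coordinates. Conjugation by it models the antipodal
map on signs. -/
def swapMat : Mat2 := !![0, 1; 1, 0]

/-- The off-diagonal matrix unit attached to a sign. -/
def signMat (b : Bool) : Mat2 := if b then !![0, 1; 0, 0] else !![0, 0; 1, 0]

theorem swapMat_mul_self : swapMat * swapMat = 1 := by decide

theorem swapMat_mul_signMat_add (b : Bool) : swapMat * signMat b + signMat b * swapMat = 1 := by
  cases b <;> decide

theorem signMat_not (b : Bool) : signMat (!b) = swapMat * signMat b * swapMat := by
  cases b <;> decide

theorem signMat_add_signMat_not (b : Bool) : signMat b + signMat (!b) = swapMat := by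
  cases b <;> decide

theorem signMat_mul_self (b : Bool) : signMat b * signMat b = 0 := by
  cases b <;> decide

/-- The product of the matrices of a word of signs; it vanishes unless the signs alternate. -/
def wordMat (l : List Bool) : Mat2 := (l.map signMat).prod

theorem wordMat_nil : wordMat [] = 1 := rfl

theorem wordMat_cons (b : Bool) (l : List Bool) : wordMat (b :: l) = signMat b * wordMat l :=
  List.prod_cons

theorem pairing_mul_left {V R : Type*} [Ring R] (a : R) (c : List (List V)) (φ : List V → R) :
    pairing c (fun l ↦ a * φ l) = a * pairing c φ :=
  List.sum_map_mul_left ..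

theorem pairing_mul_right {V R : Type*} [Ring R] (a : R) (c : List (List V)) (φ : List V → R) :
    pairing c (fun l ↦ φ l * a) = pairing c φ * a :=
  List.sum_map_mul_right ..

/-- Anticommuting with `swapMat` is a derivation modulo 2 that sends each `signMat b` to `1`, so it
deletes the letters of a word one at a time. -/
theorem coboundary_wordMat (l : List Bool) :
    coboundary wordMat l = swapMat * wordMat l + wordMat l * swapMat := by
  induction l with
  | nil => rw [coboundary_nil, wordMat_nil, mul_one, one_mul, ZModModule.add_self]
  | cons b l ih =>
    have htail : coboundary (fun q ↦ wordMat (b :: q)) l = signMat b * coboundary wordMat l := by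
      simp only [wordMat_cons]
      exact pairing_mul_left _ _ _
    rw [coboundary_cons, htail, ih, wordMat_cons]
    calc wordMat l + signMat b * (swapMat * wordMat l + wordMat l * swapMat)
        = (swapMat * signMat b + signMat b * swapMat) * wordMat l +
            signMat b * (swapMat * wordMat l + wordMat l * swapMat) := by
          rw [swapMat_mul_signMat_add, one_mul]
      _ = swapMat * (signMat b * wordMat l) + signMat b * wordMat l * swapMat +
            (signMat b * swapMat * wordMat l + signMat b * swapMat * wordMat l) := by
          noncomm_ring
      _ = _ := by rw [ZModModule.add_self, add_zero]

theorem wordMat_map_not (l : List Bool) :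
    wordMat (l.map (!·)) = swapMat * wordMat l * swapMat := by
  induction l with
  | nil => rw [List.map_nil, wordMat_nil, mul_one, swapMat_mul_self]
  | cons b l ih =>
    rw [List.map_cons, wordMat_cons, wordMat_cons, ih, signMat_not]
    calc swapMat * signMat b * swapMat * (swapMat * wordMat l * swapMat)
        = swapMat * signMat b * (swapMat * swapMat) * wordMat l * swapMat := by noncomm_ring
      _ = _ := by rw [swapMat_mul_self]; noncomm_ring

theorem wordMat_eq_zero_of_infix {l : List Bool} {b : Bool} (h : [b, b] <:+: l) :
    wordMat l = 0 := by
  obtain ⟨s, t, rfl⟩ := h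
  simp [wordMat, ← mul_assoc, signMat_mul_self]

theorem insertionSort_eq_of_perm {α : Type*} [LinearOrder α] {l l' : List α} (h : l.Perm l') :
    l.insertionSort (· ≤ ·) = l'.insertionSort (· ≤ ·) :=
  (((List.perm_insertionSort _ l).trans h).trans (List.perm_insertionSort _ l').symm).eq_of_pairwise
    (fun _ _ _ _ hab hba ↦ le_antisymm hab hba)
    (List.pairwise_insertionSort _ l) (List.pairwise_insertionSort _ l')

theorem exists_infix_of_not_nodup {α : Type*} [LinearOrder α] {l : List α}
    (hs : l.Pairwise (· ≤ ·)) (h : ¬l.Nodup) : ∃ a, [a, a] <:+: l := by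
  induction l with
  | nil => exact absurd List.nodup_nil h
  | cons x l ih =>
    obtain ⟨hx, hs⟩ := List.pairwise_cons.1 hs
    by_cases hxl : x ∈ l
    · obtain ⟨y, l, rfl⟩ := List.exists_cons_of_ne_nil (List.ne_nil_of_mem hxl)
      have hyx : y ≤ x := (List.mem_cons.1 hxl).elim Eq.ge ((List.pairwise_cons.1 hs).1 x)
      obtain rfl := le_antisymm (hx y List.mem_cons_self) hyx
      exact ⟨x, [], l, rfl⟩
    · obtain ⟨a, ha⟩ := ih hs fun hl ↦ h (List.nodup_cons.2 ⟨hxl, hl⟩)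
      exact ⟨a, ha.trans (List.suffix_cons x l).isInfix⟩

variable {m : ℕ}

/-- The opposite of a signed label. -/
def flipLabel (a : Fin m ×ₗ Bool) : Fin m ×ₗ Bool := toLex ((ofLex a).1, !(ofLex a).2)

/-- A list of signed labels containing no label together with its opposite. -/
def IsComplementFree (l : List (Fin m ×ₗ Bool)) : Prop := ∀ a ∈ l, ∀ b ∈ l, a ≠ flipLabel b

theorem eq_or_eq_flipLabel {a b : Fin m ×ₗ Bool} (h : (ofLex a).1 = (ofLex b).1) :
    a = b ∨ a = flipLabel b :=
  (Bool.eq_or_eq_not (ofLex a).2 (ofLex b).2).imp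
    (fun hs ↦ ofLex.injective (Prod.ext h hs)) (fun hs ↦ ofLex.injective (Prod.ext h hs))

theorem IsComplementFree.fst_injOn {l : List (Fin m ×ₗ Bool)} (hl : IsComplementFree l) :
    ∀ a ∈ l, ∀ b ∈ l, (ofLex a).1 = (ofLex b).1 → a = b :=
  fun a ha b hb h ↦ (eq_or_eq_flipLabel h).resolve_right (hl a ha b hb)

/-- The matrix of the word of signs of a list of labels, read in increasing order of the labels. -/
def labelMat (l : List (Fin m ×ₗ Bool)) : Mat2 :=
  wordMat ((l.insertionSort (· ≤ ·)).map fun a ↦ (ofLex a).2)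

theorem coboundary_labelMat (l : List (Fin m ×ₗ Bool)) :
    coboundary labelMat l = swapMat * labelMat l + labelMat l * swapMat := by
  have hperm (a b : List (Fin m ×ₗ Bool)) (hab : a.Perm b) : labelMat a = labelMat b := by
    rw [labelMat, labelMat, insertionSort_eq_of_perm hab]
  rw [coboundary_eq_of_perm hperm (List.perm_insertionSort (· ≤ ·) l).symm, labelMat,
    ← coboundary_wordMat, coboundary_map]
  refine pairing_congr fun q hq ↦ ?_
  rw [labelMat, ((List.pairwise_insertionSort (· ≤ ·) l).sublist
    (sublist_of_mem_faces hq)).insertionSort_eq]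

theorem insertionSort_map_flipLabel {l : List (Fin m ×ₗ Bool)} (hl : IsComplementFree l) :
    (l.map flipLabel).insertionSort (· ≤ ·) = (l.insertionSort (· ≤ ·)).map flipLabel := by
  refine ((List.perm_insertionSort _ _).trans
    ((List.perm_insertionSort (· ≤ ·) l).map flipLabel).symm).eq_of_pairwise
    (fun _ _ _ _ hab hba ↦ le_antisymm hab hba) (List.pairwise_insertionSort _ _) ?_
  refine List.pairwise_map.2
    ((List.pairwise_insertionSort (· ≤ ·) l).imp_of_mem fun {a b} ha hb hab ↦ ?_)
  rw [List.mem_insertionSort] at ha hb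
  rcases Prod.Lex.le_iff.1 hab with hlt | ⟨heq, -⟩
  · exact Prod.Lex.le_iff.2 (.inl hlt)
  · rw [hl.fst_injOn a ha b hb heq]

theorem labelMat_map_flipLabel {l : List (Fin m ×ₗ Bool)} (hl : IsComplementFree l) :
    labelMat (l.map flipLabel) = swapMat * labelMat l * swapMat := by
  rw [labelMat, insertionSort_map_flipLabel hl, labelMat, ← wordMat_map_not, List.map_map,
    List.map_map]
  rfl

theorem labelMat_eq_zero {l : List (Fin m ×ₗ Bool)} (hl : IsComplementFree l)
    (hm : m < l.length) : labelMat l = 0 := by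
  have hnd : ¬l.Nodup := fun hnd ↦ by
    have hfst : (l.map fun a ↦ (ofLex a).1).Nodup :=
      (List.nodup_map_iff_inj_on hnd).2 hl.fst_injOn
    have hcard := hfst.length_le_card
    rw [List.length_map, Fintype.card_fin] at hcard
    exact hm.not_ge hcard
  obtain ⟨a, ha⟩ := exists_infix_of_not_nodup (List.pairwise_insertionSort (· ≤ ·) l)
    (mt (List.perm_insertionSort _ l).nodup_iff.1 hnd)
  refine wordMat_eq_zero_of_infix (b := (ofLex a).2) ?_
  simpa using ha.map fun a ↦ (ofLex a).2

end Labels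

section Hemispheres

/-- The union of a chain and its image under the antipodal map. -/
def symmetrize {V : Type*} [Neg V] (c : List (List V)) : List (List V) :=
  c ++ c.map (List.map Neg.neg)

theorem pairing_symmetrize {V A : Type*} [Neg V] [AddCommGroup A] (c : List (List V))
    (φ : List V → A) :
    pairing (symmetrize c) φ = pairing c φ + pairing c fun l ↦ φ (l.map Neg.neg) := by
  rw [symmetrize, pairing_append, pairing_map]

theorem mem_symmetrize {V : Type*} [Neg V] {c : List (List V)} {l : List V} :
    l ∈ symmetrize c ↔ l ∈ c ∨ ∃ l' ∈ c, l'.map Neg.neg = l := by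
  rw [symmetrize, List.mem_append, List.mem_map]

variable {E : Type*} [NormedAddCommGroup E] [InnerProductSpace ℝ E]

/-- The map that moves the points of the unit sphere orthogonal to the pole `v` along meridians:
they start at time `0` and reach `v` at time `1`. -/
def meridian (v : E) (t : ℝ) (x : E) : E :=
  Real.cos (Real.pi / 2 * t) • x + Real.sin (Real.pi / 2 * t) • v

theorem meridian_zero (v : E) : meridian v 0 = id := by
  ext x
  simp [meridian]

theorem meridian_one (v : E) : meridian v 1 = fun _ ↦ v := by
  ext x
  simp [meridian]

theorem norm_meridian {v x : E} (hv : ‖v‖ = 1) (hx : ‖x‖ = 1) (hxv : inner ℝ x v = 0) (t : ℝ) :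
    ‖meridian v t x‖ = 1 := by
  rw [← sq_eq_sq₀ (norm_nonneg _) zero_le_one, meridian, norm_add_sq_real, norm_smul, norm_smul,
    inner_smul_left, inner_smul_right, hxv, hv, hx]
  simp

theorem norm_meridian_sub_le {v x y : E} (hv : ‖v‖ = 1) (hy : ‖y‖ = 1) (s t : ℝ) :
    ‖meridian v s x - meridian v t y‖ ≤ ‖x - y‖ + Real.pi * |s - t| := by
  have harg : |Real.pi / 2 * s - Real.pi / 2 * t| = Real.pi / 2 * |s - t| := by
    rw [← mul_sub, abs_mul, abs_of_pos Real.pi_div_two_pos]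
  have hcos := (Real.abs_cos_sub_cos_le (Real.pi / 2 * s) (Real.pi / 2 * t)).trans_eq harg
  have hsin := (Real.abs_sin_sub_sin_le (Real.pi / 2 * s) (Real.pi / 2 * t)).trans_eq harg
  calc ‖meridian v s x - meridian v t y‖
      = ‖Real.cos (Real.pi / 2 * s) • (x - y) +
          (Real.cos (Real.pi / 2 * s) - Real.cos (Real.pi / 2 * t)) • y +
          (Real.sin (Real.pi / 2 * s) - Real.sin (Real.pi / 2 * t)) • v‖ := by
        simp only [meridian]
        congr 1
        module
    _ ≤ |Real.cos (Real.pi / 2 * s)| * ‖x - y‖ +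
          |Real.cos (Real.pi / 2 * s) - Real.cos (Real.pi / 2 * t)| +
          |Real.sin (Real.pi / 2 * s) - Real.sin (Real.pi / 2 * t)| := by
        refine norm_add₃_le.trans_eq ?_
        simp only [norm_smul, Real.norm_eq_abs, hv, hy, mul_one]
    _ ≤ 1 * ‖x - y‖ + Real.pi / 2 * |s - t| + Real.pi / 2 * |s - t| := by
        gcongr
        exact Real.abs_cos_le_one _
    _ = ‖x - y‖ + Real.pi * |s - t| := by ring

/-- Finely subdivided hemispheres with poles `e 0, e 1, …`: the next one is obtained by moving both
the previous one and its antipode to the new pole in `M` steps. -/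
def hemisphere (e : ℕ → E) (M : ℕ) : ℕ → List (List E)
  | 0 => [[e 0]]
  | k + 1 => (List.range M).flatMap fun j : ℕ ↦ (symmetrize (hemisphere e M k)).flatMap
      (prism (meridian (e (k + 1)) (j / M)) (meridian (e (k + 1)) ((j + 1 : ℕ) / M)))

section Boundary

variable {A : Type*} [AddCommGroup A] [Module (ZMod 2) A]

theorem sum_range_add_succ (a : ℕ → A) (n : ℕ) :
    ((List.range n).map fun j ↦ a j + a (j + 1)).sum = a 0 + a n := by
  induction n with
  | zero => exact (ZModModule.add_self _).symm
  | succ n ih => rw [List.sum_range_succ, ih, ZModModule.add_add_add_cancel]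

theorem pairing_symmetrize_const {V : Type*} [Neg V] (c : List (List V)) (v : V)
    (φ : List V → A) :
    pairing (symmetrize c) (fun l ↦ φ (l.map fun _ ↦ v)) = 0 := by
  simp only [pairing_symmetrize, List.map_map, Function.comp_def, ZModModule.add_self]

theorem pairing_hemisphere_succ_coboundary (e : ℕ → E) {M : ℕ} (hM : M ≠ 0) {k : ℕ}
    (hc : ∀ ψ : List E → A, pairing (symmetrize (hemisphere e M k)) (coboundary ψ) = 0)
    (φ : List E → A) :
    pairing (hemisphere e M (k + 1)) (coboundary φ) =
      pairing (symmetrize (hemisphere e M k)) φ := by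
  have hM' : (M : ℝ) ≠ 0 := Nat.cast_ne_zero.2 hM
  simp only [hemisphere, pairing_flatMap (List.range M), pairing_flatMap_prism_coboundary _ _ hc]
  rw [sum_range_add_succ fun j : ℕ ↦ pairing (symmetrize (hemisphere e M k))
    fun l ↦ φ (l.map (meridian (e (k + 1)) (j / M)))]
  simp only [Nat.cast_zero, zero_div, div_self hM', meridian_zero, meridian_one, List.map_id,
    pairing_symmetrize_const, add_zero]

theorem pairing_symmetrize_hemisphere_coboundary (e : ℕ → E) {M : ℕ} (hM : M ≠ 0) (k : ℕ)
    (ψ : List E → A) : pairing (symmetrize (hemisphere e M k)) (coboundary ψ) = 0 := by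
  induction k generalizing ψ with
  | zero => simp [hemisphere, symmetrize, coboundary_cons, coboundary_nil, ZModModule.add_self]
  | succ k ih =>
    simp only [pairing_symmetrize _ (coboundary ψ), coboundary_map,
      pairing_hemisphere_succ_coboundary e hM ih, pairing_symmetrize, List.map_map, neg_comp_neg,
      List.map_id]
    rw [add_comm (pairing (hemisphere e M k) ψ), ZModModule.add_self]

end Boundary

section Vertices

variable {e : ℕ → E} {M k : ℕ} {l : List E}

theorem length_of_mem_hemisphere (hl : l ∈ hemisphere e M k) : l.length = k + 1 := by
  induction k generalizing l with
  | zero => rw [List.mem_singleton.1 hl, List.length_singleton]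
  | succ k ih =>
    simp only [hemisphere, List.mem_flatMap, mem_symmetrize] at hl
    obtain ⟨j, -, l', hl' | ⟨l', hl', rfl⟩, hl⟩ := hl
    · rw [length_of_mem_prism hl, ih hl']
    · rw [length_of_mem_prism hl, List.length_map, ih hl']

theorem exists_of_mem_hemisphere_succ (hl : l ∈ hemisphere e M (k + 1)) :
    ∃ j : ℕ, ∃ l' ∈ hemisphere e M k, ∃ s : ℝ, |s| = 1 ∧ ∀ x ∈ l,
      ∃ i : ℕ, (i = j ∨ i = j + 1) ∧ ∃ y ∈ l', x = meridian (e (k + 1)) (i / M) (s • y) := by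
  have hprism {j : ℕ} {q : List E}
      (hlq : l ∈ prism (meridian (e (k + 1)) (j / M)) (meridian (e (k + 1)) ((j + 1 : ℕ) / M)) q)
      (x : E) (hx : x ∈ l) :
      ∃ i : ℕ, (i = j ∨ i = j + 1) ∧ ∃ z ∈ q, x = meridian (e (k + 1)) (i / M) z := by
    obtain ⟨z, hz, hxz | hxz⟩ := exists_eq_or_eq_of_mem_prism hlq hx
    exacts [⟨j, .inl rfl, z, hz, hxz⟩, ⟨j + 1, .inr rfl, z, hz, hxz⟩]
  simp only [hemisphere, List.mem_flatMap, mem_symmetrize] at hl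
  obtain ⟨j, -, l', hl' | ⟨l', hl', rfl⟩, hl⟩ := hl
  · exact ⟨j, l', hl', 1, abs_one, by simpa only [one_smul] using hprism hl⟩
  · exact ⟨j, l', hl', -1, by simp, by
      simpa only [neg_one_smul, List.mem_map, exists_exists_and_eq_and] using hprism hl⟩

theorem inner_eq_zero_of_mem_hemisphere {v : E} (hv : ∀ i ≤ k, inner ℝ (e i) v = 0)
    (hl : l ∈ hemisphere e M k) {x : E} (hx : x ∈ l) : inner ℝ x v = 0 := by
  induction k generalizing l x with
  | zero =>
    rw [List.mem_singleton.1 hl, List.mem_singleton] at hx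
    rw [hx, hv 0 le_rfl]
  | succ k ih =>
    obtain ⟨j, l', hl', s, -, hmem⟩ := exists_of_mem_hemisphere_succ hl
    obtain ⟨i, -, y, hy, rfl⟩ := hmem x hx
    simp only [meridian, inner_add_left, inner_smul_left, hv (k + 1) le_rfl,
      ih (fun i hi ↦ hv i (hi.trans k.le_succ)) hl' hy, mul_zero, add_zero]

variable {n : ℕ}

theorem norm_eq_one_of_mem_hemisphere (he : Orthonormal ℝ fun i : Fin (n + 1) ↦ e i) (hk : k ≤ n)
    (hl : l ∈ hemisphere e M k) {x : E} (hx : x ∈ l) : ‖x‖ = 1 := by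
  induction k generalizing l x with
  | zero =>
    rw [List.mem_singleton.1 hl, List.mem_singleton] at hx
    rw [hx]
    exact he.1 0
  | succ k ih =>
    obtain ⟨j, l', hl', s, hs, hmem⟩ := exists_of_mem_hemisphere_succ hl
    obtain ⟨i, -, y, hy, rfl⟩ := hmem x hx
    have horth (i : ℕ) (hi : i ≤ k) : inner ℝ (e i) (e (k + 1)) = 0 :=
      he.2 (i := ⟨i, by omega⟩) (j := ⟨k + 1, by omega⟩) (by simp; omega)
    refine norm_meridian (he.1 ⟨k + 1, by omega⟩) ?_ ?_ _
    · rw [norm_smul, Real.norm_eq_abs, hs, one_mul, ih (by omega) hl' hy]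
    · rw [inner_smul_left, inner_eq_zero_of_mem_hemisphere horth hl' hy, mul_zero]

theorem norm_sub_le_of_mem_hemisphere (he : Orthonormal ℝ fun i : Fin (n + 1) ↦ e i) (hk : k ≤ n)
    (hl : l ∈ hemisphere e M k) {x y : E} (hx : x ∈ l) (hy : y ∈ l) :
    ‖x - y‖ ≤ k * (Real.pi / M) := by
  induction k generalizing l x y with
  | zero =>
    rw [List.mem_singleton.1 hl, List.mem_singleton] at hx hy
    simp [hx, hy]
  | succ k ih =>
    obtain ⟨j, l', hl', s, hs, hmem⟩ := exists_of_mem_hemisphere_succ hl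
    obtain ⟨i, hi, x, hx', rfl⟩ := hmem x hx
    obtain ⟨i', hi', y, hy', rfl⟩ := hmem y hy
    have hnorm : ‖s • y‖ = 1 := by
      rw [norm_smul, Real.norm_eq_abs, hs, one_mul,
        norm_eq_one_of_mem_hemisphere he (by omega) hl' hy']
    have htime : |(i : ℝ) / M - i' / M| ≤ 1 / M := by
      rw [← sub_div, abs_div, Nat.abs_cast]
      gcongr
      rcases hi with rfl | rfl <;> rcases hi' with rfl | rfl <;> simp
    calc ‖meridian (e (k + 1)) (i / M) (s • x) - meridian (e (k + 1)) (i' / M) (s • y)‖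
        ≤ ‖s • x - s • y‖ + Real.pi * |(i : ℝ) / M - i' / M| :=
          norm_meridian_sub_le (he.1 ⟨k + 1, by omega⟩) hnorm _ _
      _ ≤ k * (Real.pi / M) + Real.pi * (1 / M) := by
          rw [← smul_sub, norm_smul, Real.norm_eq_abs, hs, one_mul]
          gcongr
          exact ih (by omega) hl' hx' hy'
      _ = (k + 1 : ℕ) * (Real.pi / M) := by
          push_cast
          ring

end Vertices

end Hemispheres

section Tucker

variable {m : ℕ}

theorem pairing_coboundary_labelMat {V : Type*} (lab : V → Fin m ×ₗ Bool) (c : List (List V)) :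
    pairing c (coboundary fun l ↦ labelMat (l.map lab)) =
      swapMat * pairing c (fun l ↦ labelMat (l.map lab)) +
        pairing c (fun l ↦ labelMat (l.map lab)) * swapMat := by
  rw [← pairing_mul_left, ← pairing_mul_right, ← pairing_add]
  exact pairing_congr fun l _ ↦ by rw [← coboundary_labelMat, coboundary_map]

theorem pairing_labelMat_map_neg {V : Type*} [Neg V] {lab : V → Fin m ×ₗ Bool}
    {c : List (List V)} (hodd : ∀ l ∈ c, ∀ x ∈ l, lab (-x) = flipLabel (lab x))
    (hfree : ∀ l ∈ c, IsComplementFree (l.map lab)) :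
    pairing c (fun l ↦ labelMat ((l.map Neg.neg).map lab)) =
      swapMat * pairing c (fun l ↦ labelMat (l.map lab)) * swapMat := by
  rw [← pairing_mul_left, ← pairing_mul_right]
  refine pairing_congr fun l hl ↦ ?_
  rw [← labelMat_map_flipLabel (hfree l hl), List.map_map, List.map_map]
  exact congrArg labelMat (List.map_congr_left (hodd l hl))

variable {E : Type*} [NormedAddCommGroup E] [InnerProductSpace ℝ E] {e : ℕ → E} {M n : ℕ}
  {lab : E → Fin m ×ₗ Bool}

theorem pairing_symmetrize_hemisphere_labelMat (hM : M ≠ 0)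
    (hodd : ∀ k ≤ n, ∀ l ∈ hemisphere e M k, ∀ x ∈ l, lab (-x) = flipLabel (lab x))
    (hfree : ∀ k ≤ n, ∀ l ∈ hemisphere e M k, IsComplementFree (l.map lab)) {k : ℕ} (hk : k ≤ n) :
    pairing (symmetrize (hemisphere e M k)) (fun l ↦ labelMat (l.map lab)) = swapMat ^ (k + 1) := by
  rw [pairing_symmetrize, pairing_labelMat_map_neg (hodd k hk) (hfree k hk)]
  induction k with
  | zero =>
    have hpole : labelMat ([e 0].map lab) = signMat (ofLex (lab (e 0))).2 := by
      simp [labelMat, wordMat]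
    rw [hemisphere, pairing_cons, pairing_nil, add_zero, hpole, ← signMat_not,
      signMat_add_signMat_not, zero_add, pow_one]
  | succ k ih =>
    set P := pairing (hemisphere e M (k + 1)) fun l ↦ labelMat (l.map lab)
    have hboundary : swapMat * P + P * swapMat = swapMat ^ (k + 1) := by
      rw [← ih (by omega), ← pairing_labelMat_map_neg (hodd k (by omega)) (hfree k (by omega)),
        ← pairing_symmetrize (φ := fun l ↦ labelMat (l.map lab)), ← pairing_coboundary_labelMat,
        pairing_hemisphere_succ_coboundary e hM (pairing_symmetrize_hemisphere_coboundary e hM k)]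
    calc P + swapMat * P * swapMat = swapMat * (swapMat * P + P * swapMat) := by
          rw [mul_add, ← mul_assoc, swapMat_mul_self, one_mul, mul_assoc]
      _ = swapMat ^ (k + 1 + 1) := by rw [hboundary, ← pow_succ']

theorem exists_complementary_of_mem_hemisphere (hM : M ≠ 0) (hmn : m ≤ n)
    (hodd : ∀ k ≤ n, ∀ l ∈ hemisphere e M k, ∀ x ∈ l, lab (-x) = flipLabel (lab x)) :
    ∃ k ≤ n, ∃ l ∈ hemisphere e M k, ∃ x ∈ l, ∃ y ∈ l, lab x = flipLabel (lab y) := by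
  by_contra! hcon
  have hfree (k : ℕ) (hk : k ≤ n) (l : List E) (hl : l ∈ hemisphere e M k) :
      IsComplementFree (l.map lab) := by
    simpa only [IsComplementFree, List.forall_mem_map] using hcon k hk l hl
  have hvanish : pairing (hemisphere e M n) (fun l ↦ labelMat (l.map lab)) = 0 := by
    refine List.sum_eq_zero (List.forall_mem_map.2 fun l hl ↦
      labelMat_eq_zero (hfree n le_rfl l hl) ?_)
    rw [List.length_map, length_of_mem_hemisphere hl]
    omega
  have hpow := pairing_symmetrize_hemisphere_labelMat hM hodd hfree le_rfl
  rw [pairing_symmetrize, pairing_labelMat_map_neg (hodd n le_rfl) (hfree n le_rfl), hvanish,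
    mul_zero, zero_mul, add_zero] at hpow
  have hunit : IsUnit swapMat := .of_mul_eq_one swapMat swapMat_mul_self
  exact not_isUnit_zero (hpow ▸ hunit.pow (n + 1))

/-- Tucker's lemma. -/
theorem exists_dist_lt_complementary {lab : EuclideanSpace ℝ (Fin (n + 1)) → Fin m ×ₗ Bool}
    (hmn : m ≤ n)
    (hodd : ∀ x ∈ sphere (0 : EuclideanSpace ℝ (Fin (n + 1))) 1, lab (-x) = flipLabel (lab x))
    {δ : ℝ} (hδ : 0 < δ) :
    ∃ x ∈ sphere (0 : EuclideanSpace ℝ (Fin (n + 1))) 1,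
      ∃ y ∈ sphere (0 : EuclideanSpace ℝ (Fin (n + 1))) 1,
        dist x y < δ ∧ lab x = flipLabel (lab y) := by
  let e (i : ℕ) : EuclideanSpace ℝ (Fin (n + 1)) := EuclideanSpace.single (Fin.ofNat (n + 1) i) 1
  have he : Orthonormal ℝ fun i : Fin (n + 1) ↦ e i := by
    simpa only [e, Fin.ofNat_val_eq_self, ← EuclideanSpace.basisFun_apply] using
      (EuclideanSpace.basisFun (Fin (n + 1)) ℝ).orthonormal
  obtain ⟨M, hM⟩ := exists_nat_gt (n * Real.pi / δ)
  have hM0 : 0 < (M : ℝ) := lt_of_le_of_lt (by positivity) hM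
  have hmem {k : ℕ} (hk : k ≤ n) {l} (hl : l ∈ hemisphere e M k) {x} (hx : x ∈ l) :
      x ∈ sphere (0 : EuclideanSpace ℝ (Fin (n + 1))) 1 :=
    mem_sphere_zero_iff_norm.2 (norm_eq_one_of_mem_hemisphere he hk hl hx)
  obtain ⟨k, hk, l, hl, x, hx, y, hy, hxy⟩ :=
    exists_complementary_of_mem_hemisphere (Nat.cast_pos.1 hM0).ne' hmn
      fun k hk l hl x hx ↦ hodd x (hmem hk hl hx)
  refine ⟨x, hmem hk hl hx, y, hmem hk hl hy, ?_, hxy⟩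
  calc dist x y ≤ k * (Real.pi / M) := by
        rw [dist_eq_norm]
        exact norm_sub_le_of_mem_hemisphere he hk hl hx hy
    _ ≤ n * (Real.pi / M) := by gcongr
    _ < δ := by rwa [mul_div_assoc', div_lt_iff₀ hM0, ← div_lt_iff₀' hδ]

/-- The label consists of a coordinate of largest absolute value and its sign. -/
theorem exists_label (n : ℕ) [Nonempty (Fin n)] : ∃ lab : (Fin n → ℝ) → Fin n ×ₗ Bool,
    (∀ b, b ≠ 0 → lab (-b) = flipLabel (lab b)) ∧
      ∀ b b', lab b = flipLabel (lab b') → ‖b‖ ≤ ‖b - b'‖ := by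
  let idx (b : Fin n → ℝ) : Fin n := Classical.epsilon fun i ↦ ‖b‖ = |b i|
  have hidx (b : Fin n → ℝ) : ‖b‖ = |b (idx b)| := by
    have ⟨i, hi⟩ := Finite.exists_max fun i ↦ |b i|
    exact Classical.epsilon_spec (p := fun i ↦ ‖b‖ = |b i|) ⟨i, le_antisymm
      ((pi_norm_le_iff_of_nonneg (abs_nonneg _)).2 hi) (norm_le_pi_norm b i)⟩
  have hidx_neg (b : Fin n → ℝ) : idx (-b) = idx b := by
    simp only [idx, norm_neg, Pi.neg_apply, abs_neg]
  refine ⟨fun b ↦ toLex (idx b, decide (0 < b (idx b))), fun b hb ↦ ?_, fun b b' h ↦ ?_⟩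
  · have hne : b (idx b) ≠ 0 := abs_pos.1 (hidx b ▸ norm_pos_iff.2 hb)
    have hsign : decide (0 < -b (idx b)) = !decide (0 < b (idx b)) := by
      rw [← decide_not, decide_eq_decide, neg_pos, not_lt, hne.le_iff_lt]
    simp only [flipLabel, ofLex_toLex, hidx_neg, Pi.neg_apply, hsign]
  · simp only [flipLabel, ofLex_toLex, EmbeddingLike.apply_eq_iff_eq, Prod.mk.injEq,
      ← decide_not, decide_eq_decide, not_lt] at h
    obtain ⟨hi, hsign⟩ := h
    rw [← hi] at hsign
    refine ((hidx b).trans_le ?_).trans (norm_le_pi_norm (b - b') (idx b))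
    rw [Pi.sub_apply, Real.norm_eq_abs]
    grind

theorem borsuk_ulam (n : ℕ) (f : EuclideanSpace ℝ (Fin (n + 1)) → Fin n → ℝ)
    (hf : ContinuousOn f (sphere 0 1))
    (hodd : ∀ x ∈ sphere (0 : EuclideanSpace ℝ (Fin (n + 1))) 1, f (-x) = -f x) :
    ∃ x ∈ sphere (0 : EuclideanSpace ℝ (Fin (n + 1))) 1, f x = 0 := by
  by_contra! hne
  have hsphere : IsCompact (sphere (0 : EuclideanSpace ℝ (Fin (n + 1))) 1) := isCompact_sphere 0 1
  obtain ⟨x₀, hx₀, hmin⟩ :=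
    hsphere.exists_isMinOn (NormedSpace.sphere_nonempty.2 zero_le_one) hf.norm
  obtain ⟨i₀, -⟩ := Function.ne_iff.1 (hne x₀ hx₀)
  have : Nonempty (Fin n) := ⟨i₀⟩
  obtain ⟨lab, hlab, hcompl⟩ := exists_label n
  obtain ⟨δ, hδ, hunif⟩ := Metric.uniformContinuousOn_iff.1
    (hsphere.uniformContinuousOn_of_continuous hf) ‖f x₀‖ (norm_pos_iff.2 (hne x₀ hx₀))
  obtain ⟨x, hx, y, hy, hxy, hopp⟩ := exists_dist_lt_complementary (lab := fun x ↦ lab (f x))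
    le_rfl (fun x hx ↦ by rw [hodd x hx, hlab _ (hne x hx)]) hδ
  have hclose := hunif x hx y hy hxy
  rw [dist_eq_norm] at hclose
  exact hclose.not_ge ((hmin hx).trans (hcompl _ _ hopp))

end Tucker

/-! ### Minimax levels of odd maps of spheres -/

section Minimax

variable {H : Type*} [NormedAddCommGroup H] [InnerProductSpace ℝ H] {g : H → H} {u : H} {s : ℝ}

/-- The component of the vector field `g` tangent to the sphere centred at the origin. -/
def tangential (g : H → H) (u : H) : H := g u - inner ℝ (g u) u • u

/-- One step of length `s` along `g`, followed by the radial projection to the unit sphere. -/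
def ascentStep (g : H → H) (s : ℝ) (u : H) : H :=
  NormedSpace.normalize (u + s • g u)

theorem add_smul_ne_zero (hu : ‖u‖ = 1) (hs : 0 ≤ s) (hsg : s * ‖g u‖ < 1) :
    u + s • g u ≠ 0 := fun h ↦ by
  rw [← norm_neg, ← eq_neg_of_add_eq_zero_right h, norm_smul, Real.norm_of_nonneg hs] at hu
  exact hsg.ne hu

theorem ascentStep_neg (hg : g.Odd) (s : ℝ) (u : H) :
    ascentStep g s (-u) = -ascentStep g s u := by
  rw [ascentStep, hg, smul_neg, ← neg_add, NormedSpace.normalize_neg, ascentStep]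

theorem continuousOn_ascentStep (hg : ContinuousOn g (sphere 0 1)) (hs : 0 ≤ s)
    (hsg : ∀ u, ‖u‖ = 1 → s * ‖g u‖ < 1) : ContinuousOn (ascentStep g s) (sphere 0 1) := by
  have hstep : ContinuousOn (fun u ↦ u + s • g u) (sphere 0 1) :=
    continuousOn_id.add (hg.const_smul s)
  refine (hstep.norm.inv₀ fun u hu ↦ ?_).smul hstep
  have hu := mem_sphere_zero_iff_norm.1 hu
  exact norm_ne_zero_iff.2 (add_smul_ne_zero hu hs (hsg u hu))

theorem norm_sub_inner_smul_le (hu : ‖u‖ = 1) (x : H) : ‖x - inner ℝ x u • u‖ ≤ ‖x‖ := by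
  refine le_of_sq_le_sq ?_ (norm_nonneg x)
  rw [norm_sub_sq_real, inner_smul_right, norm_smul, hu, Real.norm_eq_abs, mul_one, sq_abs]
  nlinarith [sq_nonneg (inner ℝ x u)]

theorem norm_tangential_le (hu : ‖u‖ = 1) (hs : 0 < s) (hsg : s * ‖g u‖ < 1) :
    s * ‖tangential g u‖ ≤ 2 * ‖ascentStep g s u - u‖ := by
  set y := u + s • g u with hy
  have hy2 : ‖y‖ ≤ 2 := by
    have := norm_add_le u (s • g u)
    rw [hu, norm_smul, Real.norm_of_nonneg hs.le] at this
    linarith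
  have hstep : ‖y‖ • ascentStep g s u = y := NormedSpace.norm_smul_normalize y
  have htan : s • tangential g u = ‖y‖ • (ascentStep g s u - u) -
      inner ℝ (‖y‖ • (ascentStep g s u - u)) u • u := by
    rw [smul_sub, hstep, inner_sub_left, real_inner_smul_left, real_inner_self_eq_norm_sq, hu, hy,
      inner_add_left, real_inner_smul_left, real_inner_self_eq_norm_sq, hu, tangential]
    module
  calc s * ‖tangential g u‖ = ‖s • tangential g u‖ := by
        rw [norm_smul, Real.norm_of_nonneg hs.le]
    _ ≤ ‖y‖ * ‖ascentStep g s u - u‖ := by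
        rw [htan, ← norm_norm y, ← norm_smul, norm_norm]
        exact norm_sub_inner_smul_le hu _
    _ ≤ 2 * ‖ascentStep g s u - u‖ := by gcongr

theorem norm_sub_sq_le_inner_ascentStep (hu : ‖u‖ = 1) (hy : u + s • g u ≠ 0) :
    ‖ascentStep g s u - u‖ ^ 2 ≤ 2 * (s * inner ℝ (g u) (ascentStep g s u - u)) := by
  set w := ascentStep g s u
  set y := u + s • g u with hyu
  have hwn : ‖w‖ = 1 := NormedSpace.norm_normalize hy
  have hyw : ‖y‖ • w = y := NormedSpace.norm_smul_normalize y
  have hsg : s • g u = ‖y‖ • w - u := by rw [hyw, hyu]; abel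
  have hwu : ‖w - u‖ ^ 2 = 2 - 2 * inner ℝ w u := by rw [norm_sub_sq_real, hwn, hu]; ring
  calc ‖w - u‖ ^ 2 ≤ (‖y‖ + 1) * ‖w - u‖ ^ 2 := by
        nlinarith [norm_nonneg y, sq_nonneg ‖w - u‖]
    _ = 2 * (s * inner ℝ (g u) (w - u)) := by
        rw [← real_inner_smul_left, hsg, hwu, inner_sub_left, inner_sub_right, inner_sub_right,
          real_inner_smul_left, real_inner_smul_left, real_inner_self_eq_norm_sq,
          real_inner_self_eq_norm_sq, hwn, hu, real_inner_comm w u]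
        ring

/-- `g` is, up to the factor `p`, a gradient on the unit sphere of `u ↦ ⟪g u, u⟫`, with a one-sided
quadratic error bound; this is what an ascent argument along `g` needs. -/
structure IsAscentField (g : H → H) (p L M : ℝ) : Prop where
  continuousOn : ContinuousOn g (sphere 0 1)
  odd : g.Odd
  norm_le : ∀ u, ‖u‖ = 1 → ‖g u‖ ≤ M
  le_inner : ∀ u w, ‖u‖ = 1 → ‖w‖ = 1 →
    inner ℝ (g u) u + p * inner ℝ (g u) (w - u) - L * ‖w - u‖ ^ 2 ≤ inner ℝ (g w) w

variable {p L M : ℝ}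

theorem exists_ascentStep (hp : 0 < p) (hg : IsAscentField g p L M) :
    ∃ s σ : ℝ, 0 < σ ∧ 0 < s ∧ (∀ u, ‖u‖ = 1 → s * ‖g u‖ < 1) ∧ ∀ u, ‖u‖ = 1 →
      inner ℝ (g u) u + σ * ‖tangential g u‖ ^ 2 ≤
        inner ℝ (g (ascentStep g s u)) (ascentStep g s u) := by
  set s : ℝ := min (1 / (|M| + 1)) (p / (2 * (|L| + 1)))
  have hs0 : 0 < s := by positivity
  have hsM : s * (|M| + 1) ≤ 1 := (le_div_iff₀ (by positivity)).1 (min_le_left _ _)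
  have hsL : s * (2 * (|L| + 1)) ≤ p := (le_div_iff₀ (by positivity)).1 (min_le_right _ _)
  have hsg (u : H) (hu : ‖u‖ = 1) : s * ‖g u‖ < 1 := by
    nlinarith [hg.norm_le u hu, le_abs_self M]
  refine ⟨s, s ^ 2 / 4, by positivity, hs0, hsg, fun u hu ↦ ?_⟩
  have hy : u + s • g u ≠ 0 := add_smul_ne_zero hu hs0.le (hsg u hu)
  set w := ascentStep g s u
  have hLp : (|L| + 1) * ‖w - u‖ ^ 2 ≤ p * inner ℝ (g u) (w - u) := by
    have hinner := norm_sub_sq_le_inner_ascentStep hu hy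
    have : 0 ≤ s * inner ℝ (g u) (w - u) := by linarith [sq_nonneg ‖w - u‖]
    have : 0 ≤ inner ℝ (g u) (w - u) := nonneg_of_mul_nonneg_right this hs0
    nlinarith [abs_nonneg L]
  calc inner ℝ (g u) u + s ^ 2 / 4 * ‖tangential g u‖ ^ 2
      = inner ℝ (g u) u + (s * ‖tangential g u‖) ^ 2 / 4 := by ring
    _ ≤ inner ℝ (g u) u + (2 * ‖w - u‖) ^ 2 / 4 := by
        gcongr inner ℝ (g u) u + ?_ ^ 2 / 4
        exact norm_tangential_le hu hs0 (hsg u hu)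
    _ ≤ inner ℝ (g u) u + p * inner ℝ (g u) (w - u) - L * ‖w - u‖ ^ 2 := by
        nlinarith [le_abs_self L, sq_nonneg ‖w - u‖]
    _ ≤ inner ℝ (g w) w := hg.le_inner u w hu (NormedSpace.norm_normalize hy)

/-- The odd continuous maps from the unit sphere of `ℝ^(k+1)` to the unit sphere of `H`. -/
def oddSpheres (H : Type*) [NormedAddCommGroup H] (k : ℕ) :
    Set (EuclideanSpace ℝ (Fin (k + 1)) → H) :=
  {h | ContinuousOn h (sphere 0 1) ∧ h.Odd ∧ Set.MapsTo h (sphere 0 1) (sphere 0 1)}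

/-- The lower bounds of `u ↦ ⟪g u, u⟫` on the odd images of the `k`-sphere in the unit sphere. The
supremum of this set is a minimax value. -/
def sphereLevels (g : H → H) (k : ℕ) : Set ℝ :=
  {a | ∃ h ∈ oddSpheres H k, ∀ x ∈ sphere 0 1, a ≤ inner ℝ (g (h x)) (h x)}

/-- By Borsuk–Ulam, every odd image of the `k`-sphere meets the kernel of `R`. -/
theorem le_of_mem_sphereLevels {k : ℕ} {δ a : ℝ} (R : H →L[ℝ] Fin k → ℝ)
    (hR : ∀ u, ‖u‖ = 1 → R u = 0 → inner ℝ (g u) u ≤ δ) (ha : a ∈ sphereLevels g k) : a ≤ δ := by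
  obtain ⟨h, ⟨hcont, hodd, hmaps⟩, hle⟩ := ha
  obtain ⟨x, hx, hx0⟩ := borsuk_ulam k (fun x ↦ R (h x)) (R.continuous.comp_continuousOn hcont)
    fun x _ ↦ by rw [hodd, map_neg]
  exact (hle x hx).trans (hR _ (mem_sphere_zero_iff_norm.1 (hmaps hx)) hx0)

theorem ascentStep_comp_mem_oddSpheres (hg : IsAscentField g p L M) (hs : 0 ≤ s)
    (hsg : ∀ u, ‖u‖ = 1 → s * ‖g u‖ < 1) {k : ℕ} {h : EuclideanSpace ℝ (Fin (k + 1)) → H}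
    (hh : h ∈ oddSpheres H k) : ascentStep g s ∘ h ∈ oddSpheres H k := by
  obtain ⟨hcont, hodd, hmaps⟩ := hh
  refine ⟨(continuousOn_ascentStep hg.continuousOn hs hsg).comp hcont hmaps,
    fun x ↦ by simp only [Function.comp_apply, hodd x, ascentStep_neg hg.odd], fun x hx ↦ ?_⟩
  have hhx := mem_sphere_zero_iff_norm.1 (hmaps hx)
  exact mem_sphere_zero_iff_norm.2
    (NormedSpace.norm_normalize (add_smul_ne_zero hhx hs (hsg _ hhx)))

/-- If every `u` at a level close to the minimax value `c` had a large tangential field, one ascent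
step would lift a nearly optimal sphere above `c`. -/
theorem exists_palaisSmale_sequence (hp : 0 < p) (hg : IsAscentField g p L M) {k : ℕ}
    (hne : (sphereLevels g k).Nonempty) (hbdd : BddAbove (sphereLevels g k)) :
    ∃ u : ℕ → H, (∀ n, ‖u n‖ = 1) ∧
      Tendsto (fun n ↦ inner ℝ (g (u n)) (u n)) atTop (𝓝 (sSup (sphereLevels g k))) ∧
      Tendsto (fun n ↦ tangential g (u n)) atTop (𝓝 0) := by
  set c := sSup (sphereLevels g k)
  obtain ⟨s, σ, hσ, hs, hsg, hascent⟩ := exists_ascentStep hp hg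
  have hnear (n : ℕ) : ∃ u : H, ‖u‖ = 1 ∧ c - 1 / ((n : ℝ) + 1) ≤ inner ℝ (g u) u ∧
      inner ℝ (g u) u + σ * ‖tangential g u‖ ^ 2 ≤ c + 1 / ((n : ℝ) + 1) := by
    have hn : (0 : ℝ) < 1 / ((n : ℝ) + 1) := by positivity
    obtain ⟨a, ⟨h, hh, hle⟩, ha⟩ := exists_lt_of_lt_csSup hne (sub_lt_self c hn)
    by_contra! hcon
    have hlift : c + 1 / ((n : ℝ) + 1) ∈ sphereLevels g k := by
      refine ⟨_, ascentStep_comp_mem_oddSpheres hg hs.le hsg hh, fun x hx ↦ ?_⟩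
      have hhx := mem_sphere_zero_iff_norm.1 (hh.2.2 hx)
      exact (hcon _ hhx (ha.le.trans (hle x hx))).le.trans (hascent _ hhx)
    linarith [le_csSup hbdd hlift]
  choose u hu hge hle using hnear
  have hlim : Tendsto (fun n : ℕ ↦ 1 / ((n : ℝ) + 1)) atTop (𝓝 0) :=
    tendsto_one_div_add_atTop_nhds_zero_nat
  refine ⟨u, hu, ?_, ?_⟩
  · refine tendsto_of_tendsto_of_tendsto_of_le_of_le
      (by simpa only [sub_zero] using hlim.const_sub c)
      (by simpa only [add_zero] using hlim.const_add c) hge fun n ↦ ?_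
    linarith [hle n, mul_nonneg hσ.le (sq_nonneg ‖tangential g (u n)‖)]
  · have hsq : Tendsto (fun n ↦ ‖tangential g (u n)‖ ^ 2) atTop (𝓝 0) := by
      refine squeeze_zero (fun n ↦ sq_nonneg _) (fun n ↦ ?_)
        (by simpa only [mul_zero] using hlim.const_mul (2 / σ))
      rw [div_mul_eq_mul_div, le_div_iff₀ hσ]
      linarith [hge n, hle n]
    exact tendsto_zero_iff_norm_tendsto_zero.2 (by simpa [Real.sqrt_sq] using hsq.sqrt)

theorem mul_dist_le_dist_smul_add {A : H → H} (hA : ∀ u v, 0 ≤ inner ℝ (A u - A v) (u - v))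
    (c : ℝ) (u v : H) : c * dist u v ≤ dist (c • u + A u) (c • v + A v) := by
  rcases eq_or_ne u v with rfl | huv
  · simp
  rw [dist_eq_norm, dist_eq_norm]
  refine le_of_mul_le_mul_right ?_ (norm_pos_iff.2 (sub_ne_zero.2 huv))
  calc c * ‖u - v‖ * ‖u - v‖ ≤ c * ‖u - v‖ * ‖u - v‖ + inner ℝ (A u - A v) (u - v) :=
        le_add_of_nonneg_right (hA u v)
    _ = inner ℝ (c • u + A u - (c • v + A v)) (u - v) := by
        rw [add_sub_add_comm, ← smul_sub, inner_add_left, real_inner_smul_left,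
          real_inner_self_eq_norm_mul_norm, mul_assoc]
    _ ≤ ‖c • u + A u - (c • v + A v)‖ * ‖u - v‖ := real_inner_le_norm _ _

/-- The Palais–Smale condition at positive levels, for a compact field minus a monotone one. -/
theorem exists_eigenvector_of_palaisSmale [CompleteSpace H] {gB gC : H → H}
    (hgcont : ContinuousOn g (sphere 0 1)) (hsplit : ∀ u, g u = gB u - gC u)
    (hmono : ∀ u v, 0 ≤ inner ℝ (gC u - gC v) (u - v))
    (hcomp : IsCompact (closure (gB '' sphere 0 1)))
    {c : ℝ} (hc : 0 < c) {u : ℕ → H} (hu : ∀ n, ‖u n‖ = 1)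
    (hlevel : Tendsto (fun n ↦ inner ℝ (g (u n)) (u n)) atTop (𝓝 c))
    (htan : Tendsto (fun n ↦ tangential g (u n)) atTop (𝓝 0)) :
    ∃ v : H, ‖v‖ = 1 ∧ g v = c • v := by
  have hres : Tendsto (fun n ↦ g (u n) - c • u n) atTop (𝓝 0) := by
    have hdev : Tendsto (fun n ↦ (inner ℝ (g (u n)) (u n) - c) • u n) atTop (𝓝 0) := by
      refine tendsto_zero_iff_norm_tendsto_zero.2 ?_
      simpa [norm_smul, hu] using (hlevel.sub_const c).abs
    have hadd := htan.add hdev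
    rw [add_zero] at hadd
    refine hadd.congr fun n ↦ ?_
    rw [tangential]; module
  obtain ⟨b, -, φ, hφ, hb⟩ := hcomp.tendsto_subseq (x := fun n ↦ gB (u n)) fun n ↦
    subset_closure ⟨u n, mem_sphere_zero_iff_norm.2 (hu n), rfl⟩
  have hsum : CauchySeq fun n ↦ c • u (φ n) + gC (u (φ n)) := by
    refine ((hb.sub (hres.comp hφ.tendsto_atTop)).congr fun n ↦ ?_).cauchySeq
    simp only [Function.comp_apply, hsplit]; abel
  have hcauchy : CauchySeq fun n ↦ u (φ n) := by
    rw [Metric.cauchySeq_iff] at hsum ⊢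
    intro ε hε
    obtain ⟨n₀, hn₀⟩ := hsum (c * ε) (by positivity)
    exact ⟨n₀, fun m hm n hn ↦ lt_of_mul_lt_mul_left
      ((mul_dist_le_dist_smul_add hmono c _ _).trans_lt (hn₀ m hm n hn)) hc.le⟩
  obtain ⟨v, hv⟩ := cauchySeq_tendsto_of_complete hcauchy
  have hvn : ‖v‖ = 1 := tendsto_nhds_unique hv.norm (by simp [hu])
  have hgv : Tendsto (fun n ↦ g (u (φ n))) atTop (𝓝 (g v)) :=
    (hgcont v (mem_sphere_zero_iff_norm.2 hvn)).tendsto.comp (tendsto_nhdsWithin_iff.2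
      ⟨hv, Eventually.of_forall fun n ↦ mem_sphere_zero_iff_norm.2 (hu _)⟩)
  exact ⟨v, hvn, sub_eq_zero.1
    (tendsto_nhds_unique (hgv.sub (hv.const_smul c)) (hres.comp hφ.tendsto_atTop))⟩

end Minimax

section CompactOperators

variable {H F : Type*} [NormedAddCommGroup F] [NormedSpace ℝ F]

/-- Norming functionals of a finite net of `T '' closedBall 0 1` do the job. -/
theorem exists_ker_norm_le_of_isCompactOperator [NormedAddCommGroup H] [NormedSpace ℝ H]
    {T : H →L[ℝ] F} (hT : IsCompactOperator T) {δ : ℝ} (hδ : 0 < δ) :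
    ∃ (k : ℕ) (R : H →L[ℝ] Fin k → ℝ), ∀ v, ‖v‖ = 1 → R v = 0 → ‖T v‖ ≤ δ := by
  obtain ⟨t, -, htfin, ht⟩ := finite_cover_balls_of_compact
    (hT.isCompact_closure_image_closedBall 1) (half_pos hδ)
  choose f hf1 hf using fun y : F ↦ exists_dual_vector'' ℝ y
  let e := htfin.toFinset.equivFin.symm
  refine ⟨_, ContinuousLinearMap.pi fun i ↦ (f (e i)).comp T, fun v hv hRv ↦ ?_⟩
  obtain ⟨y, hy, hvy⟩ := Set.mem_iUnion₂.1
    (ht (subset_closure ⟨v, mem_closedBall_zero_iff.2 hv.le, rfl⟩))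
  replace hvy : ‖T v - y‖ < δ / 2 := by rwa [mem_ball, dist_eq_norm] at hvy
  have hfTv : f y (T v) = 0 := by
    have h := congrFun hRv (e.symm ⟨y, htfin.mem_toFinset.2 hy⟩)
    rwa [ContinuousLinearMap.pi_apply, Equiv.apply_symm_apply] at h
  have hynorm : ‖y‖ ≤ ‖T v - y‖ := calc
    ‖y‖ = -f y (T v - y) := by rw [map_sub, hfTv, hf]; simp
    _ ≤ ‖f y‖ * ‖T v - y‖ := (neg_le_abs _).trans ((f y).le_opNorm _)
    _ ≤ ‖T v - y‖ := mul_le_of_le_one_left (norm_nonneg _) (hf1 y)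
  linarith [norm_le_norm_sub_add (T v) y]

/-- `T` is approximated by its compositions with the projections onto the finite-dimensional spaces
`(ker R)ᗮ`. -/
theorem isCompactOperator_of_forall_ker_norm_le [NormedAddCommGroup H] [InnerProductSpace ℝ H]
    [CompleteSpace H] [CompleteSpace F] {T : H →L[ℝ] F}
    (hT : ∀ δ > 0, ∃ (k : ℕ) (R : H →L[ℝ] Fin k → ℝ), ∀ v, R v = 0 → ‖T v‖ ≤ δ * ‖v‖) :
    IsCompactOperator T := by
  have happrox (n : ℕ) : ∃ S : H →L[ℝ] F, IsCompactOperator S ∧ ‖S - T‖ ≤ 1 / ((n : ℝ) + 1) := by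
    obtain ⟨k, R, hR⟩ := hT (1 / ((n : ℝ) + 1)) (by positivity)
    set K := R.ker
    have : CompleteSpace K := R.isClosed_ker.completeSpace_coe
    have : FiniteDimensional ℝ Kᗮ := by
      refine FiniteDimensional.of_injective (R.toLinearMap.domRestrict Kᗮ) ?_
      rw [← LinearMap.ker_eq_bot, LinearMap.ker_eq_bot']
      exact fun x hx ↦ Subtype.ext
        (inner_self_eq_zero.1 (Submodule.inner_right_of_mem_orthogonal (K := K) hx x.2))
    refine ⟨T ∘L Kᗮ.subtypeL ∘L Kᗮ.orthogonalProjectionOnto,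
      (isCompactOperator_of_locallyCompactSpace_dom Kᗮ.orthogonalProjectionOnto).clm_comp
        (T ∘L Kᗮ.subtypeL),
      ContinuousLinearMap.opNorm_le_bound _ (by positivity) fun v ↦ ?_⟩
    have hdecomp : (K.orthogonalProjectionOnto v : H) + Kᗮ.orthogonalProjectionOnto v = v :=
      K.starProjection_add_starProjection_orthogonal v
    have herr : (T ∘L Kᗮ.subtypeL ∘L Kᗮ.orthogonalProjectionOnto - T) v =
        -T (K.orthogonalProjectionOnto v : H) := by
      have hTv := congrArg T hdecomp
      rw [map_add] at hTv
      rw [sub_apply, ← hTv]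
      exact sub_add_cancel_right _ _
    rw [herr, norm_neg]
    refine (hR _ (K.orthogonalProjectionOnto v).2).trans ?_
    gcongr
    exact K.norm_orthogonalProjectionOnto_apply_le v
  choose S hS hST using happrox
  refine isCompactOperator_of_tendsto (l := atTop) ?_ (Eventually.of_forall hS)
  exact tendsto_iff_norm_sub_tendsto_zero.2 (squeeze_zero (fun n ↦ norm_nonneg _) hST
    tendsto_one_div_add_atTop_nhds_zero_nat)

end CompactOperators

/-! ### Duality maps and the Palais–Smale condition -/

section DualityMaps

variable {F G H : Type*} [NormedAddCommGroup F] [NormedSpace ℝ F] [NormedAddCommGroup G]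
  [NormedSpace ℝ G] [NormedAddCommGroup H] [InnerProductSpace ℝ H]
  {p : ℝ} {J : F → StrongDual ℝ F} {J' : G → StrongDual ℝ G}

/-- `J` is a locally Lipschitz, homogeneous duality map of weight `t ↦ t ^ (p - 1)`, that is, a
selection of subgradients of `‖·‖ ^ p / p`. -/
structure IsDualityMap (p : ℝ) (J : F → StrongDual ℝ F) : Prop where
  apply_self : ∀ U, J U U = ‖U‖ ^ p
  norm_le : ∀ U, ‖J U‖ ≤ ‖U‖ ^ (p - 1)
  smul : ∀ (t : ℝ) U, J (t • U) = (|t| ^ (p - 2) * t) • J U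
  lipschitzOnWith : ∀ r, ∃ K, LipschitzOnWith K J (closedBall 0 r)

namespace IsDualityMap

theorem continuous (hJ : IsDualityMap p J) : Continuous J := by
  refine continuous_iff_continuousAt.2 fun U ↦ ?_
  obtain ⟨K, hK⟩ := hJ.lipschitzOnWith (‖U‖ + 1)
  exact hK.continuousOn.continuousAt (mem_of_superset (ball_mem_nhds U one_pos) fun V hV ↦ by
    rw [mem_closedBall_zero_iff]
    linarith [norm_le_norm_sub_add V U, mem_ball_iff_norm.1 hV])

/-- The subgradient inequality, by Young's inequality. -/
theorem norm_rpow_add_le (hp : 1 < p) (hJ : IsDualityMap p J) (U V : F) :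
    ‖U‖ ^ p + p * J U (V - U) ≤ ‖V‖ ^ p := by
  have hpq := Real.HolderConjugate.conjExponent hp
  have : 0 < p := by linarith
  have hpow : (‖U‖ ^ (p - 1)) ^ p.conjExponent = ‖U‖ ^ p := by
    rw [← Real.rpow_mul (norm_nonneg U), hpq.sub_one_mul_conj]
  have hyoung : J U V ≤ ‖V‖ ^ p / p + ‖U‖ ^ p / p.conjExponent := calc
    J U V ≤ ‖J U‖ * ‖V‖ := (le_abs_self _).trans ((J U).le_opNorm V)
    _ ≤ ‖U‖ ^ (p - 1) * ‖V‖ := by gcongr; exact hJ.norm_le U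
    _ ≤ ‖V‖ ^ p / p + ‖U‖ ^ p / p.conjExponent := by
      rw [mul_comm, ← hpow]
      exact Real.young_inequality_of_nonneg (norm_nonneg V) (by positivity) hpq
  have hconj : p / p.conjExponent = p - 1 := by
    rw [Real.conjExponent]; field_simp
  calc ‖U‖ ^ p + p * J U (V - U) = p * J U V - (p - 1) * ‖U‖ ^ p := by
        rw [map_sub, hJ.apply_self]; ring
    _ ≤ p * (‖V‖ ^ p / p + ‖U‖ ^ p / p.conjExponent) - (p - 1) * ‖U‖ ^ p := by gcongr
    _ = ‖V‖ ^ p := by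
        rw [← hconj]; field_simp; ring

end IsDualityMap

variable [CompleteSpace H]

/-- The gradient of `u ↦ ‖T u‖ ^ p / p` on a Hilbert space when `J` is a duality map of weight
`t ↦ t ^ (p - 1)`. -/
def pullback (J : F → StrongDual ℝ F) (T : H →L[ℝ] F) (u : H) : H :=
  (InnerProductSpace.toDual ℝ H).symm (J (T u) ∘L T)

theorem inner_pullback (J : F → StrongDual ℝ F) (T : H →L[ℝ] F) (u w : H) :
    inner ℝ (pullback J T u) w = J (T u) (T w) :=
  InnerProductSpace.toDual_symm_apply

namespace IsDualityMap

theorem inner_pullback_self (hJ : IsDualityMap p J) (T : H →L[ℝ] F) (u : H) :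
    inner ℝ (pullback J T u) u = ‖T u‖ ^ p := by
  rw [inner_pullback, hJ.apply_self]

theorem pullback_smul (hJ : IsDualityMap p J) (T : H →L[ℝ] F) (t : ℝ) (u : H) :
    pullback J T (t • u) = (|t| ^ (p - 2) * t) • pullback J T u := by
  rw [pullback, map_smul, hJ.smul, ContinuousLinearMap.smul_comp, map_smul, pullback]

theorem odd_pullback (hJ : IsDualityMap p J) (T : H →L[ℝ] F) : (pullback J T).Odd := fun u ↦ by
  simpa using hJ.pullback_smul T (-1) u

theorem norm_rpow_add_inner_pullback_le (hp : 1 < p) (hJ : IsDualityMap p J) (T : H →L[ℝ] F)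
    (u w : H) : ‖T u‖ ^ p + p * inner ℝ (pullback J T u) (w - u) ≤ ‖T w‖ ^ p := by
  rw [inner_pullback, map_sub]
  exact hJ.norm_rpow_add_le hp _ _

theorem inner_pullback_sub_nonneg (hp : 1 < p) (hJ : IsDualityMap p J) (T : H →L[ℝ] F)
    (u v : H) : 0 ≤ inner ℝ (pullback J T u - pullback J T v) (u - v) := by
  have huv := hJ.norm_rpow_add_inner_pullback_le hp T u v
  have hvu := hJ.norm_rpow_add_inner_pullback_le hp T v u
  rw [← neg_sub u v, inner_neg_right] at huv
  rw [inner_sub_left]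
  nlinarith

theorem lipschitzOnWith_pullback (hJ : IsDualityMap p J) (T : H →L[ℝ] F) :
    ∃ K, LipschitzOnWith K (pullback J T) (sphere 0 1) := by
  obtain ⟨K, hK⟩ := hJ.lipschitzOnWith ‖T‖
  refine ⟨K * ‖T‖₊ * ‖T‖₊, LipschitzOnWith.of_dist_le_mul fun u hu v hv ↦ ?_⟩
  have hT (w : H) (hw : w ∈ sphere (0 : H) 1) : T w ∈ closedBall (0 : F) ‖T‖ := by
    simpa [mem_sphere_zero_iff_norm.1 hw] using T.le_opNorm w
  calc dist (pullback J T u) (pullback J T v) = ‖(J (T u) - J (T v)) ∘L T‖ := by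
        rw [pullback, pullback, LinearIsometryEquiv.dist_map, dist_eq_norm,
          ContinuousLinearMap.sub_comp]
    _ ≤ ‖J (T u) - J (T v)‖ * ‖T‖ := ContinuousLinearMap.opNorm_comp_le _ _
    _ ≤ K * (‖T‖ * dist u v) * ‖T‖ := by
        rw [← dist_eq_norm]
        gcongr
        exact (hK.dist_le_mul _ (hT u hu) _ (hT v hv)).trans
          (mul_le_mul_of_nonneg_left (T.lipschitz.dist_le_mul u v) K.2)
    _ = _ := by push_cast; ring

theorem isCompact_closure_pullback_sphere (hJ : IsDualityMap p J) {T : H →L[ℝ] F}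
    (hT : IsCompactOperator T) : IsCompact (closure (pullback J T '' sphere 0 1)) := by
  have hcont : Continuous fun U ↦ (InnerProductSpace.toDual ℝ H).symm (J U ∘L T) :=
    (InnerProductSpace.toDual ℝ H).symm.continuous.comp
      (((ContinuousLinearMap.compL ℝ H F ℝ).flip T).continuous.comp hJ.continuous)
  refine ((hT.isCompact_closure_image_closedBall 1).image hcont).closure_of_subset ?_
  rintro _ ⟨u, hu, rfl⟩
  exact ⟨T u, subset_closure ⟨u, sphere_subset_closedBall hu, rfl⟩, rfl⟩

theorem exists_isAscentField (hp : 1 < p) (hJ : IsDualityMap p J) (hJ' : IsDualityMap p J')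
    (T : H →L[ℝ] F) (S : H →L[ℝ] G) :
    ∃ L M, IsAscentField (pullback J T - pullback J' S) p L M := by
  obtain ⟨K, hK⟩ := hJ.lipschitzOnWith_pullback T
  obtain ⟨K', hK'⟩ := hJ'.lipschitzOnWith_pullback S
  have hodd : (pullback J T - pullback J' S).Odd := fun u ↦ by
    simp only [Pi.sub_apply, hJ.odd_pullback T u, hJ'.odd_pullback S u, neg_sub_neg, neg_sub]
  have hlip : LipschitzOnWith (K + K') (pullback J T - pullback J' S) (sphere 0 1) := hK.sub hK'
  refine ⟨p * K', K + K', hlip.continuousOn, hodd, fun u hu ↦ ?_, fun u w hu hw ↦ ?_⟩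
  · have h := hlip.norm_sub_le (mem_sphere_zero_iff_norm.2 hu)
      (mem_sphere_zero_iff_norm.2 ((norm_neg u).trans hu))
    rw [hodd, sub_neg_eq_add, sub_neg_eq_add, ← two_smul ℝ, ← two_smul ℝ u, norm_smul, norm_smul,
      hu] at h
    norm_num only [NNReal.coe_add, Real.norm_ofNat] at h
    linarith
  · have hT := hJ.norm_rpow_add_inner_pullback_le hp T u w
    have hS := hJ'.norm_rpow_add_inner_pullback_le hp S w u
    have hmono : inner ℝ (pullback J' S w - pullback J' S u) (w - u) ≤ K' * ‖w - u‖ ^ 2 := calc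
      _ ≤ ‖pullback J' S w - pullback J' S u‖ * ‖w - u‖ := real_inner_le_norm _ _
      _ ≤ K' * ‖w - u‖ * ‖w - u‖ := by
        gcongr
        exact hK'.norm_sub_le (mem_sphere_zero_iff_norm.2 hw) (mem_sphere_zero_iff_norm.2 hu)
      _ = K' * ‖w - u‖ ^ 2 := by ring
    rw [← neg_sub w u, inner_neg_right] at hS
    rw [inner_sub_left] at hmono
    simp only [Pi.sub_apply, inner_sub_left, hJ.inner_pullback_self, hJ'.inner_pullback_self]
    nlinarith

end IsDualityMap

theorem exists_linearIsometry_of_not_finiteDimensional {E : Type*} [NormedAddCommGroup E]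
    [InnerProductSpace ℝ E] (hE : ¬FiniteDimensional ℝ E) (k : ℕ) :
    Nonempty (EuclideanSpace ℝ (Fin k) →ₗᵢ[ℝ] E) := by
  obtain ⟨v, hv⟩ : ∃ v : Fin k → E, LinearIndependent ℝ v := exists_linearIndependent_of_le_rank
    (Cardinal.natCast_lt_aleph0.le.trans (not_lt.1 (mt Module.rank_lt_aleph0_iff.1 hE)))
  let W := Submodule.span ℝ (Set.range v)
  have : FiniteDimensional ℝ W := FiniteDimensional.span_of_finite ℝ (Set.finite_range v)
  have hW : Module.finrank ℝ W = k := by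
    rw [finrank_span_eq_card hv, Fintype.card_fin]
  let b := (stdOrthonormalBasis ℝ W).reindex (finCongr hW)
  exact ⟨W.subtypeₗᵢ.comp b.repr.symm.toLinearIsometry⟩

theorem exists_pos_mem_sphereLevels (hJ : IsDualityMap p J) (hJ' : IsDualityMap p J') (hp : 0 < p)
    {T : H →L[ℝ] F} {S : H →L[ℝ] G} (hS : ¬FiniteDimensional ℝ S.ker)
    (hTS : Disjoint T.ker S.ker) (k : ℕ) :
    ∃ a ∈ sphereLevels (pullback J T - pullback J' S) k, 0 < a := by
  obtain ⟨ι⟩ := exists_linearIsometry_of_not_finiteDimensional hS (k + 1)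
  set h : EuclideanSpace ℝ (Fin (k + 1)) → H := fun x ↦ ι x
  have hcont : Continuous h := continuous_subtype_val.comp ι.continuous
  have hnorm (x) : ‖h x‖ = ‖x‖ := ι.norm_map x
  obtain ⟨x, hx, hmin⟩ := (isCompact_sphere (0 : EuclideanSpace ℝ (Fin (k + 1))) 1).exists_isMinOn
    (NormedSpace.sphere_nonempty.2 zero_le_one) (T.continuous.comp hcont).norm.continuousOn
  refine ⟨‖T (h x)‖ ^ p, ⟨h, ⟨hcont.continuousOn, fun x ↦ by simp [h], fun x hx ↦ ?_⟩,
    fun x hx ↦ ?_⟩, Real.rpow_pos_of_pos (norm_pos_iff.2 fun hTx ↦ ?_) p⟩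
  · rwa [mem_sphere_zero_iff_norm, hnorm, ← mem_sphere_zero_iff_norm]
  · have hSx : S (h x) = 0 := (ι x).2
    rw [Pi.sub_apply, inner_sub_left, hJ.inner_pullback_self, hJ'.inner_pullback_self, hSx,
      norm_zero, Real.zero_rpow hp.ne', sub_zero]
    exact Real.rpow_le_rpow (norm_nonneg _) (hmin hx) hp.le
  · have hhx : h x = 0 := Submodule.disjoint_def.1 hTS (h x) hTx (ι x).2
    rw [mem_sphere_zero_iff_norm, ← hnorm, hhx, norm_zero] at hx
    exact zero_ne_one hx

/-- Since `T` is compact, Borsuk–Ulam makes the minimax values small. -/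
theorem exists_sphereLevels_le (hJ : IsDualityMap p J) (hJ' : IsDualityMap p J') (hp : 0 < p)
    {T : H →L[ℝ] F} (hT : IsCompactOperator T) (S : H →L[ℝ] G) {δ : ℝ} (hδ : 0 < δ) :
    ∃ k, ∀ a ∈ sphereLevels (pullback J T - pullback J' S) k, a ≤ δ := by
  obtain ⟨k, R, hR⟩ := exists_ker_norm_le_of_isCompactOperator hT (δ := δ ^ p⁻¹) (by positivity)
  refine ⟨k, fun a ↦ le_of_mem_sphereLevels R fun u hu hRu ↦ ?_⟩
  rw [Pi.sub_apply, inner_sub_left, hJ.inner_pullback_self, hJ'.inner_pullback_self]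
  calc ‖T u‖ ^ p - ‖S u‖ ^ p ≤ ‖T u‖ ^ p := sub_le_self _ (by positivity)
    _ ≤ (δ ^ p⁻¹) ^ p := Real.rpow_le_rpow (norm_nonneg _) (hR u hu hRu) hp.le
    _ = δ := Real.rpow_inv_rpow hδ.le hp.ne'

theorem exists_small_eigenvalue (hJ : IsDualityMap p J) (hJ' : IsDualityMap p J') (hp : 1 < p)
    {T : H →L[ℝ] F} (hT : IsCompactOperator T) {S : H →L[ℝ] G} (hS : ¬FiniteDimensional ℝ S.ker)
    (hTS : Disjoint T.ker S.ker) {δ : ℝ} (hδ : 0 < δ) :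
    ∃ c u, 0 < c ∧ c ≤ δ ∧ ‖u‖ = 1 ∧ pullback J T u - pullback J' S u = c • u := by
  have hp0 : 0 < p := by linarith
  obtain ⟨L, M, hg⟩ := hJ.exists_isAscentField hp hJ' T S
  obtain ⟨k, hk⟩ := exists_sphereLevels_le hJ hJ' hp0 hT S hδ
  obtain ⟨a, ha, ha0⟩ := exists_pos_mem_sphereLevels hJ hJ' hp0 hS hTS k
  have hc := ha0.trans_le (le_csSup ⟨δ, hk⟩ ha)
  obtain ⟨u, hu, hlevel, htan⟩ := exists_palaisSmale_sequence hp0 hg ⟨a, ha⟩ ⟨δ, hk⟩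
  obtain ⟨v, hv, hgv⟩ := exists_eigenvector_of_palaisSmale hg.continuousOn (fun _ ↦ rfl)
    (hJ'.inner_pullback_sub_nonneg hp S) (hJ.isCompact_closure_pullback_sphere hT) hc hu hlevel htan
  exact ⟨_, v, hc, csSup_le ⟨a, ha⟩ hk, hv, hgv⟩

/-- An eigenvector with eigenvalue `c` becomes a solution after scaling by `c ^ (-1 / (p - 2))`. -/
theorem exists_le_norm_inner_eq_sub (hJ : IsDualityMap p J) (hJ' : IsDualityMap p J') (hp : 2 < p)
    {T : H →L[ℝ] F} (hT : IsCompactOperator T) {S : H →L[ℝ] G} (hS : ¬FiniteDimensional ℝ S.ker)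
    (hTS : Disjoint T.ker S.ker) (r : ℝ) :
    ∃ v, r ≤ ‖v‖ ∧ ∀ w, inner ℝ v w = J (T v) (T w) - J' (S v) (S w) := by
  have hp2 : 0 < p - 2 := by linarith
  have : 0 < max r 1 := by positivity
  obtain ⟨c, u, hc, hcr, hu, huc⟩ := exists_small_eigenvalue hJ hJ' (by linarith) hT hS hTS
    (δ := (max r 1)⁻¹ ^ (p - 2)) (by positivity)
  set t := (c ^ (p - 2)⁻¹)⁻¹ with ht
  have ht0 : 0 < t := by positivity
  have htc : t ^ (p - 2) * c = 1 := by
    rw [ht, Real.inv_rpow (by positivity), Real.rpow_inv_rpow hc.le hp2.ne', inv_mul_cancel₀ hc.ne']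
  have hrt : r ≤ t := by
    refine (le_max_left r 1).trans ((le_inv_comm₀ (by positivity) (by positivity)).1 ?_)
    exact (Real.rpow_inv_le_iff_of_pos hc.le (by positivity) hp2).2 hcr
  refine ⟨t • u, ?_, fun w ↦ ?_⟩
  · rwa [norm_smul, hu, mul_one, Real.norm_of_nonneg ht0.le]
  · have hfield : pullback J T (t • u) - pullback J' S (t • u) = t • u := by
      rw [hJ.pullback_smul, hJ'.pullback_smul, ← smul_sub, huc, abs_of_pos ht0, smul_smul,
        mul_right_comm, htc, one_mul]
    rw [← inner_pullback J T, ← inner_pullback J' S, ← inner_sub_left, hfield]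

end DualityMaps

section DualPower

open scoped ENNReal

theorem abs_rpow_mul_self_sub_le {p : ℝ} (hp : 2 ≤ p) (a b : ℝ) :
    |(|a| ^ (p - 2) * a - |b| ^ (p - 2) * b)| ≤
      (p - 1) * (|a| ^ (p - 2) + |b| ^ (p - 2)) * |a - b| := by
  wlog hab : |b| ≤ |a| generalizing a b
  · rw [abs_sub_comm, abs_sub_comm a, add_comm]
    exact this b a (not_le.1 hab).le
  have hp2 : 0 ≤ p - 2 := by linarith
  have hmono : |b| ^ (p - 2) ≤ |a| ^ (p - 2) := by gcongr
  have hpow (t : ℝ) : |t| ^ (p - 1) = |t| ^ (p - 2) * |t| := by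
    rw [← Real.rpow_add_one' (abs_nonneg t) (by linarith)]; ring_nf
  have hconvex : (p - 1) * (|a| ^ (p - 2) * |b|) ≤ (p - 2) * |a| ^ (p - 1) + |b| ^ (p - 1) := by
    have hp1 : p - 1 ≠ 0 := by linarith
    have h := Real.geom_mean_le_arith_mean2_weighted (w₁ := (p - 2) / (p - 1)) (w₂ := 1 / (p - 1))
      (p₁ := |a| ^ (p - 1)) (p₂ := |b| ^ (p - 1)) (div_nonneg hp2 (by linarith))
      (div_nonneg zero_le_one (by linarith)) (by positivity) (by positivity)
      (by field_simp; ring)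
    rw [← Real.rpow_mul (abs_nonneg a), ← Real.rpow_mul (abs_nonneg b), mul_div_cancel₀ _ hp1,
      mul_div_cancel₀ _ hp1, Real.rpow_one] at h
    calc _ ≤ (p - 1) * _ := mul_le_mul_of_nonneg_left h (by linarith)
      _ = _ := by field_simp
  calc |(|a| ^ (p - 2) * a - |b| ^ (p - 2) * b)|
      = |(|a| ^ (p - 2) * (a - b) + (|a| ^ (p - 2) - |b| ^ (p - 2)) * b)| := by ring_nf
    _ ≤ |a| ^ (p - 2) * |a - b| + (|a| ^ (p - 2) - |b| ^ (p - 2)) * |b| := by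
        refine (abs_add_le _ _).trans_eq ?_
        rw [abs_mul, abs_mul, abs_of_nonneg (sub_nonneg.2 hmono), abs_of_nonneg (by positivity)]
    _ ≤ |a| ^ (p - 2) * |a - b| + (p - 2) * |a| ^ (p - 2) * (|a| - |b|) := by
        rw [hpow, hpow] at hconvex
        linarith
    _ ≤ |a| ^ (p - 2) * |a - b| + (p - 2) * |a| ^ (p - 2) * |a - b| := by
        gcongr
        exact abs_sub_abs_le_abs_sub a b
    _ ≤ (p - 1) * (|a| ^ (p - 2) + |b| ^ (p - 2)) * |a - b| := by
        have : 0 ≤ (p - 1) * (|b| ^ (p - 2) * |a - b|) := mul_nonneg (by linarith) (by positivity)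
        linarith

variable {X : Type*} [MeasurableSpace X] {ν : Measure X} {p : ℝ}

theorem lintegral_rpow_mul_mul_le (hp : 2 ≤ p) {f g h : X → ℝ≥0∞} (hf : AEMeasurable f ν)
    (hg : AEMeasurable g ν) (hh : AEMeasurable h ν) :
    ∫⁻ x, f x ^ (p - 2) * g x * h x ∂ν ≤ (∫⁻ x, f x ^ p ∂ν) ^ ((p - 2) / p) *
      (∫⁻ x, g x ^ p ∂ν) ^ (1 / p) * (∫⁻ x, h x ^ p ∂ν) ^ (1 / p) := by
  have hp0 : p ≠ 0 := by linarith
  have hholder := ENNReal.lintegral_prod_norm_pow_le (μ := ν) (Finset.univ : Finset (Fin 3))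
    (f := ![fun x ↦ f x ^ p, fun x ↦ g x ^ p, fun x ↦ h x ^ p]) (p := ![(p - 2) / p, 1 / p, 1 / p])
    (by
      simpa [Fin.forall_fin_succ] using ⟨hf.pow_const p, hg.pow_const p, hh.pow_const p⟩)
    (by simp [Fin.sum_univ_three]; field_simp; ring)
    (by
      have : 0 ≤ p := by linarith
      simpa [Fin.forall_fin_succ, this] using div_nonneg (by linarith) this)
  simpa only [Fin.prod_univ_three, Matrix.cons_val_zero, Matrix.cons_val_one, Matrix.cons_val,
    ← ENNReal.rpow_mul, mul_div_cancel₀ _ hp0, ENNReal.rpow_one] using hholder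

variable [Fact (1 ≤ ENNReal.ofReal p)]

theorem lintegral_enorm_rpow_eq (hp : 0 < p) (f : Lp ℝ (ENNReal.ofReal p) ν) :
    ∫⁻ x, ‖f x‖ₑ ^ p ∂ν = ‖f‖ₑ ^ p := by
  have h := eLpNorm_eq_lintegral_rpow_enorm_toReal (μ := ν) (f := f) (p := ENNReal.ofReal p)
    (by simpa using hp) ENNReal.ofReal_ne_top
  rw [ENNReal.toReal_ofReal hp.le] at h
  rw [Lp.enorm_def, h, ← ENNReal.rpow_mul, one_div_mul_cancel hp.ne', ENNReal.rpow_one]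

theorem lintegral_enorm_rpow_mul_mul_le (hp : 2 ≤ p) (f g h : Lp ℝ (ENNReal.ofReal p) ν) :
    ∫⁻ x, ‖|f x| ^ (p - 2) * g x * h x‖ₑ ∂ν ≤ ‖f‖ₑ ^ (p - 2) * ‖g‖ₑ * ‖h‖ₑ := by
  have hp0 : 0 < p := by linarith
  have hholder := lintegral_rpow_mul_mul_le hp (Lp.aestronglyMeasurable f).enorm
    (Lp.aestronglyMeasurable g).enorm (Lp.aestronglyMeasurable h).enorm
  simp only [lintegral_enorm_rpow_eq hp0, ← ENNReal.rpow_mul, mul_div_cancel₀ _ hp0.ne',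
    ENNReal.rpow_one] at hholder
  refine (lintegral_congr fun x ↦ ?_).trans_le hholder
  rw [enorm_mul, enorm_mul, Real.enorm_rpow_of_nonneg (abs_nonneg _) (by linarith),
    Real.enorm_abs]

theorem integrable_abs_rpow_mul_mul (hp : 2 ≤ p) (f g h : Lp ℝ (ENNReal.ofReal p) ν) :
    Integrable (fun x ↦ |f x| ^ (p - 2) * g x * h x) ν :=
  ⟨((((Lp.aestronglyMeasurable f).norm.aemeasurable.pow_const (p - 2)).mul
      (Lp.aestronglyMeasurable g).aemeasurable).mul
      (Lp.aestronglyMeasurable h).aemeasurable).aestronglyMeasurable,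
    (lintegral_enorm_rpow_mul_mul_le hp f g h).trans_lt <| by
      have : 0 ≤ p - 2 := by linarith
      finiteness⟩

theorem integral_norm_abs_rpow_mul_mul_le (hp : 2 ≤ p) (f g h : Lp ℝ (ENNReal.ofReal p) ν) :
    ∫ x, ‖|f x| ^ (p - 2) * g x * h x‖ ∂ν ≤ ‖f‖ ^ (p - 2) * ‖g‖ * ‖h‖ := by
  rw [integral_norm_eq_lintegral_enorm (integrable_abs_rpow_mul_mul hp f g h).1]
  refine ENNReal.toReal_le_of_le_ofReal (by positivity) ?_
  rw [ENNReal.ofReal_mul (by positivity), ENNReal.ofReal_mul (by positivity),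
    ← ENNReal.ofReal_rpow_of_nonneg (norm_nonneg _) (by linarith)]
  simpa only [ofReal_norm] using lintegral_enorm_rpow_mul_mul_le hp f g h

/-- The duality map `U ↦ |U| ^ (p - 2) * U` of `L^p`, with values in the dual space. -/
def dualPower (hp : 2 ≤ p) (U : Lp ℝ (ENNReal.ofReal p) ν) :
    StrongDual ℝ (Lp ℝ (ENNReal.ofReal p) ν) :=
  LinearMap.mkContinuous
    { toFun W := ∫ x, |U x| ^ (p - 2) * U x * W x ∂ν
      map_add' W Z := by
        rw [← integral_add (integrable_abs_rpow_mul_mul hp U U W)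
          (integrable_abs_rpow_mul_mul hp U U Z)]
        refine integral_congr_ae ?_
        filter_upwards [Lp.coeFn_add W Z] with x hx
        rw [hx, Pi.add_apply, mul_add]
      map_smul' c W := by
        rw [RingHom.id_apply, smul_eq_mul, ← integral_const_mul]
        refine integral_congr_ae ?_
        filter_upwards [Lp.coeFn_smul c W] with x hx
        rw [hx, Pi.smul_apply, smul_eq_mul, mul_left_comm] }
    (‖U‖ ^ (p - 2) * ‖U‖)
    fun W ↦ (norm_integral_le_integral_norm _).trans (integral_norm_abs_rpow_mul_mul_le hp U U W)

theorem dualPower_apply (hp : 2 ≤ p) (U W : Lp ℝ (ENNReal.ofReal p) ν) :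
    dualPower hp U W = ∫ x, |U x| ^ (p - 2) * U x * W x ∂ν :=
  rfl

theorem norm_dualPower_le (hp : 2 ≤ p) (U : Lp ℝ (ENNReal.ofReal p) ν) :
    ‖dualPower hp U‖ ≤ ‖U‖ ^ (p - 2) * ‖U‖ :=
  LinearMap.mkContinuous_norm_le _ (by positivity) _

theorem dualPower_apply_self (hp : 2 ≤ p) (U : Lp ℝ (ENNReal.ofReal p) ν) :
    dualPower hp U U = ‖U‖ ^ p := by
  have hint : ∫ x, |U x| ^ (p - 2) * U x * U x ∂ν = ∫ x, ‖U x‖ ^ p ∂ν := by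
    congr! 2 with x
    rw [mul_assoc, ← abs_mul_abs_self, ← sq, ← Real.rpow_two,
      ← Real.rpow_add_of_nonneg (abs_nonneg _) (by linarith) zero_le_two, sub_add_cancel,
      Real.norm_eq_abs]
  rw [dualPower_apply, hint,
    integral_eq_lintegral_of_nonneg_ae (.of_forall fun x ↦ by positivity)
      ((Lp.aestronglyMeasurable U).norm.aemeasurable.pow_const p).aestronglyMeasurable]
  simp_rw [← ENNReal.ofReal_rpow_of_nonneg (norm_nonneg _) (show 0 ≤ p by linarith), ofReal_norm]
  rw [lintegral_enorm_rpow_eq (by linarith), ← ENNReal.toReal_rpow, toReal_enorm]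

theorem dualPower_smul (hp : 2 ≤ p) (t : ℝ) (U : Lp ℝ (ENNReal.ofReal p) ν) :
    dualPower hp (t • U) = (|t| ^ (p - 2) * t) • dualPower hp U := by
  ext W
  rw [smul_apply, dualPower_apply, dualPower_apply, smul_eq_mul, ← integral_const_mul]
  refine integral_congr_ae ?_
  filter_upwards [Lp.coeFn_smul t U] with x hx
  rw [hx, Pi.smul_apply, smul_eq_mul, abs_mul, Real.mul_rpow (abs_nonneg t) (abs_nonneg _)]
  ring

theorem norm_dualPower_sub_le (hp : 2 ≤ p) (U V : Lp ℝ (ENNReal.ofReal p) ν) :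
    ‖dualPower hp U - dualPower hp V‖ ≤
      (p - 1) * (‖U‖ ^ (p - 2) + ‖V‖ ^ (p - 2)) * ‖U - V‖ := by
  have hp1 : 0 ≤ p - 1 := by linarith
  refine ContinuousLinearMap.opNorm_le_bound _ (by positivity) fun W ↦ ?_
  have hU := integrable_abs_rpow_mul_mul hp U (U - V) W
  have hV := integrable_abs_rpow_mul_mul hp V (U - V) W
  calc ‖dualPower hp U W - dualPower hp V W‖
      = ‖∫ x, (|U x| ^ (p - 2) * U x * W x - |V x| ^ (p - 2) * V x * W x) ∂ν‖ := by
        rw [integral_sub (integrable_abs_rpow_mul_mul hp U U W)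
          (integrable_abs_rpow_mul_mul hp V V W), dualPower_apply, dualPower_apply]
    _ ≤ ∫ x, (p - 1) * (‖|U x| ^ (p - 2) * (U - V) x * W x‖ +
          ‖|V x| ^ (p - 2) * (U - V) x * W x‖) ∂ν := by
        refine norm_integral_le_of_norm_le ((hU.norm.add hV.norm).const_mul _) ?_
        filter_upwards [Lp.coeFn_sub U V] with x hx
        rw [hx, Pi.sub_apply, ← sub_mul, norm_mul, norm_mul, norm_mul, norm_mul, norm_mul,
          Real.norm_of_nonneg (by positivity : 0 ≤ |U x| ^ (p - 2)),
          Real.norm_of_nonneg (by positivity : 0 ≤ |V x| ^ (p - 2)), ← add_mul, ← add_mul,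
          ← mul_assoc, ← mul_assoc]
        gcongr
        exact abs_rpow_mul_self_sub_le hp _ _
    _ ≤ (p - 1) * (‖U‖ ^ (p - 2) * ‖U - V‖ * ‖W‖ + ‖V‖ ^ (p - 2) * ‖U - V‖ * ‖W‖) := by
        rw [integral_const_mul, integral_add hU.norm hV.norm]
        gcongr <;> exact integral_norm_abs_rpow_mul_mul_le hp _ _ _
    _ = (p - 1) * (‖U‖ ^ (p - 2) + ‖V‖ ^ (p - 2)) * ‖U - V‖ * ‖W‖ := by ring

theorem isDualityMap_dualPower (hp : 2 ≤ p) :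
    IsDualityMap p (dualPower hp : Lp ℝ (ENNReal.ofReal p) ν → _) where
  apply_self := dualPower_apply_self hp
  norm_le U := (norm_dualPower_le hp U).trans_eq <| by
    rw [← Real.rpow_add_one' (norm_nonneg U) (by linarith)]; ring_nf
  smul := dualPower_smul hp
  lipschitzOnWith r := by
    have hp1 : 0 ≤ p - 1 := by linarith
    have : 0 ≤ p - 2 := by linarith
    refine ⟨_, LipschitzOnWith.of_dist_le' (K := (p - 1) * (r ^ (p - 2) + r ^ (p - 2)))
      fun U hU V hV ↦ ?_⟩
    rw [mem_closedBall_zero_iff] at hU hV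
    rw [dist_eq_norm, dist_eq_norm]
    refine (norm_dualPower_sub_le hp U V).trans ?_
    gcongr

end DualPower

/-! ### Compactness of the Sobolev embedding on bounded sets -/

section Translation

open scoped Convolution

theorem abs_integral_mul_le_eLpNorm {X : Type*} [MeasurableSpace X] {μ : Measure X} {f h : X → ℝ}
    (hf : MemLp f 2 μ) (hh : MemLp h 2 μ) :
    |∫ x, f x * h x ∂μ| ≤ (eLpNorm f 2 μ).toReal * (eLpNorm h 2 μ).toReal := by
  have hcs := abs_real_inner_le_norm (hh.toLp h) (hf.toLp f)
  rw [L2.inner_def, Lp.norm_toLp, Lp.norm_toLp, mul_comm] at hcs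
  refine le_of_eq_of_le (congrArg _ (integral_congr_ae ?_)) hcs
  filter_upwards [hf.coeFn_toLp, hh.coeFn_toLp] with x hx hx'
  rw [hx, hx', Real.inner_apply, mul_comm]

theorem norm_le_of_dense_of_abs_inner_le {E : Type*} [NormedAddCommGroup E]
    [InnerProductSpace ℝ E] {s : Set E} (hs : Dense s) {x : E} {C : ℝ} (hC : 0 ≤ C)
    (h : ∀ y ∈ s, |inner ℝ x y| ≤ C * ‖y‖) : ‖x‖ ≤ C := by
  have hclosed : IsClosed {y : E | |inner ℝ x y| ≤ C * ‖y‖} :=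
    isClosed_le (continuous_const.inner continuous_id).abs (continuous_const.mul continuous_norm)
  have hx : |inner ℝ x x| ≤ C * ‖x‖ := hclosed.closure_subset_iff.2 h (hs x)
  rw [real_inner_self_eq_norm_mul_norm, abs_mul_self] at hx
  rcases (norm_nonneg x).eq_or_lt with h0 | h0
  · rwa [← h0]
  · exact le_of_mul_le_mul_right hx h0

variable {N : ℕ}

theorem integral_fn_mul_fderiv (v : H1 N) {φ : Space N → ℝ} (hφ : ContDiff ℝ ∞ φ)
    (hφc : HasCompactSupport φ) (w : Space N) :
    ∫ x, fn v x * fderiv ℝ φ x w = -∫ x, φ x * inner ℝ w (grad v x) := by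
  have hweak : ∫ x, fn v x • gradient φ x = -∫ x, φ x • grad v x := v.2 φ hφ hφc
  have hgradient (x : Space N) : inner ℝ w (gradient φ x) = fderiv ℝ φ x w := by
    rw [real_inner_comm, gradient, InnerProductSpace.toDual_symm_apply]
  simpa only [inner_neg_right, ← integral_inner (integrable_smul_gradient (fn v) hφ hφc),
    ← integral_inner (integrable_test_smul (grad v) hφ hφc), inner_smul_right, hgradient]
    using congrArg (inner ℝ w) hweak

theorem abs_integral_fn_mul_fderiv_le (v : H1 N) {φ : Space N → ℝ} (hφ : ContDiff ℝ ∞ φ)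
    (hφc : HasCompactSupport φ) (w : Space N) :
    |∫ x, fn v x * fderiv ℝ φ x w| ≤ (eLpNorm φ 2 volume).toReal * ‖grad v‖ * ‖w‖ := by
  have hgrad : eLpNorm (fun x ↦ inner ℝ w (grad v x)) 2 volume ≤
      ENNReal.ofReal ‖w‖ * eLpNorm (grad v) 2 volume :=
    eLpNorm_le_mul_eLpNorm_of_ae_le_mul (.of_forall fun x ↦ norm_inner_le_norm _ _) 2
  rw [integral_fn_mul_fderiv v hφ hφc, abs_neg]
  calc _ ≤ (eLpNorm φ 2 volume).toReal * (eLpNorm (fun x ↦ inner ℝ w (grad v x)) 2 volume).toReal :=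
        abs_integral_mul_le_eLpNorm (hφ.continuous.memLp_of_hasCompactSupport hφc)
          ((Lp.memLp (grad v)).const_inner w)
    _ ≤ (eLpNorm φ 2 volume).toReal * (ENNReal.ofReal ‖w‖ * eLpNorm (grad v) 2 volume).toReal := by
        gcongr
        exact ENNReal.mul_ne_top ENNReal.ofReal_ne_top (Lp.eLpNorm_ne_top (grad v))
    _ = _ := by
        rw [ENNReal.toReal_mul, ENNReal.toReal_ofReal (norm_nonneg w), ← Lp.norm_def]
        ring

theorem norm_convolution_fderiv_le (v : H1 N) {ψ : Space N → ℝ} (hψ : ContDiff ℝ ∞ ψ)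
    (hψc : HasCompactSupport ψ) (y : Space N) :
    ‖(fn v ⋆[(ContinuousLinearMap.lsmul ℝ ℝ).precompR (Space N), volume] fderiv ℝ ψ) y‖ ≤
      (eLpNorm ψ 2 volume).toReal * ‖grad v‖ := by
  refine ContinuousLinearMap.opNorm_le_bound _ (by positivity) fun w ↦ ?_
  have hfderiv (x : Space N) : fderiv ℝ (fun x ↦ ψ (y - x)) x w = -fderiv ℝ ψ (y - x) w := by
    have hcomp : HasFDerivAt (fun x ↦ ψ (y - x))
        ((fderiv ℝ ψ (y - x)).comp (-ContinuousLinearMap.id ℝ (Space N))) x :=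
      (hψ.differentiable (by simp) (y - x)).hasFDerivAt.comp x ((hasFDerivAt_id x).const_sub y)
    rw [hcomp.fderiv]
    simp
  have h := abs_integral_fn_mul_fderiv_le v (φ := fun x ↦ ψ (y - x))
    (hψ.comp (contDiff_const.sub contDiff_id)) (hψc.comp_homeomorph (Homeomorph.subLeft y)) w
  have hnorm : eLpNorm (fun x ↦ ψ (y - x)) 2 volume = eLpNorm ψ 2 volume :=
    eLpNorm_comp_measurePreserving hψ.continuous.aestronglyMeasurable
      (Measure.measurePreserving_sub_left volume y)
  simp only [hfderiv, mul_neg, integral_neg, abs_neg, hnorm] at h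
  rwa [convolution_precompR_apply _ ((Lp.memLp (fn v)).locallyIntegrable one_le_two)
    (hψc.fderiv ℝ) (hψ.continuous_fderiv (by simp)), convolution_def]

theorem abs_integral_fn_mul_translate_sub_le (v : H1 N) {φ : Space N → ℝ} (hφ : ContDiff ℝ ∞ φ)
    (hφc : HasCompactSupport φ) (z : Space N) :
    |(∫ x, fn v x * φ (x - z)) - ∫ x, fn v x * φ x| ≤
      ‖z‖ * ‖grad v‖ * (eLpNorm φ 2 volume).toReal := by
  set ψ : Space N → ℝ := fun x ↦ φ (-x)
  have hψ : ContDiff ℝ ∞ ψ := hφ.comp contDiff_neg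
  have hψc : HasCompactSupport ψ := hφc.comp_homeomorph (Homeomorph.neg (Space N))
  have hnorm : eLpNorm ψ 2 volume = eLpNorm φ 2 volume :=
    eLpNorm_comp_measurePreserving hφ.continuous.aestronglyMeasurable
      (Measure.measurePreserving_neg volume)
  have h := Convex.norm_image_sub_le_of_norm_hasFDerivWithin_le (𝕜 := ℝ) (s := Set.univ)
    (fun y _ ↦ (hψc.hasFDerivAt_convolution_right (ContinuousLinearMap.lsmul ℝ ℝ)
      ((Lp.memLp (fn v)).locallyIntegrable one_le_two) (hψ.of_le (by simp)) y).hasFDerivWithinAt)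
    (fun y _ ↦ norm_convolution_fderiv_le v hψ hψc y) convex_univ (Set.mem_univ 0) (Set.mem_univ z)
  simp only [convolution_def, ContinuousLinearMap.lsmul_apply, smul_eq_mul, ψ, neg_sub, sub_zero,
    Real.norm_eq_abs] at h
  rw [hnorm] at h
  exact h.trans_eq (by ring)

theorem eLpNorm_translate_sub_le (v : H1 N) (z : Space N) :
    eLpNorm (fun x ↦ fn v (x + z) - fn v x) 2 volume ≤ ENNReal.ofReal (‖z‖ * ‖grad v‖) := by
  have hvz : MemLp (fun x ↦ fn v (x + z)) 2 volume :=
    (Lp.memLp (fn v)).comp_measurePreserving (measurePreserving_add_right volume z)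
  have hD : MemLp (fun x ↦ fn v (x + z) - fn v x) 2 volume := hvz.sub (Lp.memLp (fn v))
  suffices h : ‖hD.toLp‖ ≤ ‖z‖ * ‖grad v‖ by
    rw [Lp.norm_toLp] at h
    exact (ENNReal.le_ofReal_iff_toReal_le hD.2.ne (by positivity)).2 h
  refine norm_le_of_dense_of_abs_inner_le (Lp.dense_hasCompactSupport_contDiff (by norm_num))
    (by positivity) ?_
  rintro f ⟨φ, hfφ, hφc, hφ⟩
  have hφ2 : MemLp φ 2 volume := hφ.continuous.memLp_of_hasCompactSupport hφc
  have hinner : inner ℝ hD.toLp f = (∫ x, fn v x * φ (x - z)) - ∫ x, fn v x * φ x := calc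
    inner ℝ hD.toLp f = ∫ x, (fn v (x + z) * φ x - fn v x * φ x) := by
      rw [L2.inner_def]
      refine integral_congr_ae ?_
      filter_upwards [hD.coeFn_toLp, hfφ] with x hx hx'
      rw [hx, hx', Real.inner_apply, sub_mul]
    _ = (∫ x, fn v (x + z) * φ x) - ∫ x, fn v x * φ x :=
      integral_sub (hvz.integrable_mul hφ2) ((Lp.memLp (fn v)).integrable_mul hφ2)
    _ = (∫ x, fn v x * φ (x - z)) - ∫ x, fn v x * φ x := by
      rw [← integral_add_right_eq_self (fun x ↦ fn v x * φ (x - z)) z]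
      simp only [add_sub_cancel_right]
  rw [hinner, Lp.norm_def f, eLpNorm_congr_ae hfφ]
  exact abs_integral_fn_mul_translate_sub_le v hφ hφc z

end Translation

section Average

variable {X : Type*} [MeasurableSpace X] {μ : Measure X}

theorem eLpNorm_two_sq {F : Type*} [NormedAddCommGroup F] (f : X → F) :
    eLpNorm f 2 μ ^ 2 = ∫⁻ x, ‖f x‖ₑ ^ 2 ∂μ := by
  have h := eLpNorm_nnreal_pow_eq_lintegral (μ := μ) (f := f) (p := 2) two_ne_zero
  simpa using h

theorem enorm_sub_integral_sq_le [IsProbabilityMeasure μ] {f : X → ℝ} (hf : Integrable f μ)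
    (c : ℝ) : ‖c - ∫ x, f x ∂μ‖ₑ ^ 2 ≤ ∫⁻ x, ‖f x - c‖ₑ ^ 2 ∂μ := by
  have hsub : (∫ x, f x ∂μ) - c = ∫ x, (f x - c) ∂μ := by
    rw [integral_sub hf (integrable_const c), integral_const, probReal_univ, one_smul]
  rw [← eLpNorm_two_sq, ← neg_sub, enorm_neg, hsub]
  gcongr
  calc ‖∫ x, (f x - c) ∂μ‖ₑ ≤ ∫⁻ x, ‖f x - c‖ₑ ∂μ := enorm_integral_le_lintegral_enorm _
    _ = eLpNorm (fun x ↦ f x - c) 1 μ := eLpNorm_one_eq_lintegral_enorm.symm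
    _ ≤ eLpNorm (fun x ↦ f x - c) 2 μ :=
      eLpNorm_le_eLpNorm_of_exponent_le one_le_two
        (hf.aestronglyMeasurable.sub aestronglyMeasurable_const)

theorem enorm_sub_setAverage_sq_le {s : Set X} (hs0 : μ s ≠ 0) (hs : μ s ≠ ⊤) {f : X → ℝ}
    (hf : IntegrableOn f s μ) (c : ℝ) :
    ‖c - ⨍ x in s, f x ∂μ‖ₑ ^ 2 ≤ (μ s)⁻¹ * ∫⁻ x in s, ‖f x - c‖ₑ ^ 2 ∂μ := by
  have : IsFiniteMeasure (μ.restrict s) := ⟨by rwa [Measure.restrict_apply_univ, lt_top_iff_ne_top]⟩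
  have : NeZero (μ.restrict s) := ⟨by rwa [Ne, Measure.restrict_eq_zero]⟩
  rw [← Measure.restrict_apply_univ s, ← smul_eq_mul, ← lintegral_smul_measure]
  exact enorm_sub_integral_sq_le (hf.to_average) c

theorem eLpNorm_le_rpow_mul_rpow_of_enorm_le {F : Type*} [NormedAddCommGroup F] {f : X → F}
    (hfm : AEStronglyMeasurable f μ) {M : ENNReal} {p q : ℝ} (hq : 0 < q) (hqp : q ≤ p)
    (hf : ∀ᵐ x ∂μ, ‖f x‖ₑ ≤ M) :
    eLpNorm f (ENNReal.ofReal p) μ ≤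
      M ^ (1 - q / p) * eLpNorm f (ENNReal.ofReal q) μ ^ (q / p) := by
  have hp : 0 < p := hq.trans_le hqp
  have hpow {r : ℝ} (hr : 0 < r) :
      eLpNorm f (ENNReal.ofReal r) μ = (∫⁻ x, ‖f x‖ₑ ^ r ∂μ) ^ (1 / r) := by
    rw [eLpNorm_eq_lintegral_rpow_enorm_toReal (by simpa using hr) ENNReal.ofReal_ne_top,
      ENNReal.toReal_ofReal hr.le]
  have hint : ∫⁻ x, ‖f x‖ₑ ^ p ∂μ ≤ M ^ (p - q) * ∫⁻ x, ‖f x‖ₑ ^ q ∂μ := by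
    rw [← lintegral_const_mul'' _ (hfm.enorm.pow_const q)]
    refine lintegral_mono_ae (hf.mono fun x hx ↦ ?_)
    calc ‖f x‖ₑ ^ p = ‖f x‖ₑ ^ (p - q) * ‖f x‖ₑ ^ q := by
          rw [← ENNReal.rpow_add_of_nonneg _ _ (sub_nonneg.2 hqp) hq.le, sub_add_cancel]
      _ ≤ M ^ (p - q) * ‖f x‖ₑ ^ q := by gcongr
  rw [hpow hp, hpow hq, ← ENNReal.rpow_mul]
  calc (∫⁻ x, ‖f x‖ₑ ^ p ∂μ) ^ (1 / p)
      ≤ (M ^ (p - q) * ∫⁻ x, ‖f x‖ₑ ^ q ∂μ) ^ (1 / p) := by gcongr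
    _ = _ := by
      rw [ENNReal.mul_rpow_of_nonneg _ _ (by positivity), ← ENNReal.rpow_mul]
      congr 2 <;> field_simp

end Average

section Dyadic

variable {N : ℕ} {j : ℕ}

/-- The integer vector `⌊2ʲ x⌋` indexing the dyadic cube of side `2⁻ʲ` that contains `x`. -/
def cell (j : ℕ) (x : Space N) : Fin N → ℤ := fun i ↦ ⌊(2 : ℝ) ^ j * x i⌋

/-- The half-open dyadic cube of side `2⁻ʲ` with index `k`. -/
def cube (j : ℕ) (k : Fin N → ℤ) : Set (Space N) := {x | cell j x = k}

/-- The conditional expectation of `u` on the dyadic cubes of side `2⁻ʲ`: at `x`, the average of `u`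
over the cube containing `x`. -/
def cubeAverage (j : ℕ) (u : Space N → ℝ) (x : Space N) : ℝ :=
  ⨍ y in cube j (cell j x), u y

theorem measurable_cell (j : ℕ) : Measurable (cell j : Space N → Fin N → ℤ) :=
  measurable_pi_lambda _ fun i ↦ Int.measurable_floor.comp
    ((EuclideanSpace.proj (𝕜 := ℝ) i).continuous.measurable.const_mul _)

theorem measurableSet_cube (k : Fin N → ℤ) : MeasurableSet (cube j k) :=
  measurable_cell j (measurableSet_singleton k)

theorem measurable_cubeAverage (j : ℕ) (u : Space N → ℝ) : Measurable (cubeAverage j u) :=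
  (Measurable.of_discrete (f := fun k ↦ ⨍ y in cube j k, u y)).comp (measurable_cell j)

theorem cubeAverage_eq_of_cell_eq {u : Space N → ℝ} {x y : Space N} (h : cell j x = cell j y) :
    cubeAverage j u x = cubeAverage j u y := by
  rw [cubeAverage, cubeAverage, h]

theorem cell_eq_of_cell_succ_eq {x y : Space N} (h : cell (j + 1) x = cell (j + 1) y) :
    cell j x = cell j y := by
  have hdiv (x : Space N) (i : Fin N) : cell j x i = cell (j + 1) x i / 2 := by
    have hhalf : (2 : ℝ) ^ j * x i = 2 ^ (j + 1) * x i / (2 : ℕ) := by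
      push_cast
      ring
    rw [cell, cell, hhalf, Int.floor_div_natCast]
    rfl
  funext i
  rw [hdiv, hdiv, h]

theorem abs_sub_le_of_cell_eq {x y : Space N} (h : cell j y = cell j x) (i : Fin N) :
    |y i - x i| ≤ ((2 : ℝ) ^ j)⁻¹ := by
  have hfloor : |(2 : ℝ) ^ j * y i - 2 ^ j * x i| < 1 :=
    Int.abs_sub_lt_one_of_floor_eq_floor (congrFun h i)
  rw [← mul_sub, abs_mul, abs_of_pos (by positivity)] at hfloor
  rw [← one_div, le_div_iff₀' (by positivity)]
  exact hfloor.le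

theorem volume_cube (k : Fin N → ℤ) :
    volume (cube j k) = ENNReal.ofReal (((2 : ℝ) ^ j)⁻¹ ^ N) := by
  have h2j : (0 : ℝ) < 2 ^ j := by positivity
  have hcube : cube j k = (WithLp.ofLp : Space N → Fin N → ℝ) ⁻¹'
      Set.univ.pi fun i ↦ Set.Ico (k i / 2 ^ j : ℝ) ((k i + 1) / 2 ^ j) := by
    ext x
    simp only [cube, Set.mem_ofPred_eq, Set.mem_preimage, funext_iff, cell, Int.floor_eq_iff,
      Set.mem_univ_pi, Set.mem_Ico, div_le_iff₀' h2j, lt_div_iff₀' h2j]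
  have hside (i : Fin N) : ((k i : ℝ) + 1) / 2 ^ j - k i / 2 ^ j = ((2 : ℝ) ^ j)⁻¹ := by
    rw [← sub_div, add_sub_cancel_left, one_div]
  rw [hcube, (PiLp.volume_preserving_ofLp (Fin N)).measure_preimage
    (MeasurableSet.univ_pi fun i ↦ measurableSet_Ico).nullMeasurableSet, Real.volume_pi_Ico]
  simp only [hside, Finset.prod_const, Finset.card_univ, Fintype.card_fin]
  rw [ENNReal.ofReal_pow (by positivity)]

theorem volume_cube_ne_zero (k : Fin N → ℤ) : volume (cube j k) ≠ 0 := by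
  rw [volume_cube, ENNReal.ofReal_ne_zero_iff]
  positivity

theorem volume_cube_ne_top (k : Fin N → ℤ) : volume (cube j k) ≠ ⊤ := by
  rw [volume_cube]
  exact ENNReal.ofReal_ne_top

theorem finite_cell_image {B : Set (Space N)} (hB : Bornology.IsBounded B) (j : ℕ) :
    (cell j '' B).Finite := by
  obtain ⟨r, hr⟩ := hB.exists_norm_le
  refine (Set.finite_Icc (fun _ ↦ ⌊-((2 : ℝ) ^ j * r)⌋) fun _ ↦ ⌊(2 : ℝ) ^ j * r⌋).subset ?_
  rintro _ ⟨x, hx, rfl⟩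
  have hcoord (i : Fin N) : |(2 : ℝ) ^ j * x i| ≤ 2 ^ j * r := by
    rw [abs_mul, abs_of_pos (by positivity)]
    gcongr
    exact (PiLp.norm_apply_le x i).trans (hr x hx)
  exact ⟨fun i ↦ Int.floor_mono (abs_le.1 (hcoord i)).1,
    fun i ↦ Int.floor_mono (abs_le.1 (hcoord i)).2⟩

end Dyadic

section Poincare

variable {N : ℕ} {j : ℕ}

/-- The cube `{z : |zᵢ| ≤ r for all i}`, which contains the difference of any two points of a cube
of side `r`. -/
def box (N : ℕ) (r : ℝ) : Set (Space N) := WithLp.ofLp ⁻¹' closedBall (0 : Fin N → ℝ) r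

theorem measurableSet_box (r : ℝ) : MeasurableSet (box N r) :=
  (PiLp.volume_preserving_ofLp (Fin N)).measurable measurableSet_closedBall

theorem volume_box {r : ℝ} (hr : 0 ≤ r) : volume (box N r) = ENNReal.ofReal ((2 * r) ^ N) := by
  rw [box, (PiLp.volume_preserving_ofLp (Fin N)).measure_preimage
    measurableSet_closedBall.nullMeasurableSet, Real.volume_pi_closedBall _ hr, Fintype.card_fin]

theorem norm_sq_le_of_mem_box {r : ℝ} {z : Space N} (hz : z ∈ box N r) : ‖z‖ ^ 2 ≤ N * r ^ 2 := by
  rw [box, Set.mem_preimage, mem_closedBall_zero_iff] at hz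
  calc ‖z‖ ^ 2 = ∑ i, ‖z i‖ ^ 2 := EuclideanSpace.norm_sq_eq z
    _ ≤ ∑ _i : Fin N, r ^ 2 := by gcongr with i; exact (norm_le_pi_norm z.ofLp i).trans hz
    _ = N * r ^ 2 := by simp

theorem sub_mem_box_of_cell_eq {x y : Space N} (h : cell j y = cell j x) :
    y - x ∈ box N ((2 : ℝ) ^ j)⁻¹ := by
  rw [box, Set.mem_preimage, mem_closedBall_zero_iff, pi_norm_le_iff_of_nonneg (by positivity)]
  exact abs_sub_le_of_cell_eq h

theorem integrableOn_cube (f : Lp ℝ 2 (volume : Measure (Space N))) (k : Fin N → ℤ) :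
    IntegrableOn f (cube j k) :=
  have : IsFiniteMeasure (volume.restrict (cube j k)) :=
    ⟨by rw [Measure.restrict_apply_univ]; exact (volume_cube_ne_top k).lt_top⟩
  ((Lp.memLp f).restrict _).integrable one_le_two

theorem enorm_sub_cubeAverage_sq_le (f : Lp ℝ 2 (volume : Measure (Space N))) (j : ℕ)
    (x : Space N) :
    ‖f x - cubeAverage j f x‖ₑ ^ 2 ≤ (ENNReal.ofReal (((2 : ℝ) ^ j)⁻¹ ^ N))⁻¹ *
      ∫⁻ z in box N ((2 : ℝ) ^ j)⁻¹, ‖f (x + z) - f x‖ₑ ^ 2 := by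
  set Q := cube j (cell j x)
  have hsub : (x + ·) ⁻¹' Q ⊆ box N ((2 : ℝ) ^ j)⁻¹ := fun z hz ↦ by
    simpa using sub_mem_box_of_cell_eq (x := x) (y := x + z) hz
  have htranslate : ∫⁻ y in Q, ‖f y - f x‖ₑ ^ 2 =
      ∫⁻ z in (x + ·) ⁻¹' Q, ‖f (x + z) - f x‖ₑ ^ 2 :=
    ((measurePreserving_add_left volume x).setLIntegral_comp_preimage (measurableSet_cube _)
      (((Lp.stronglyMeasurable f).measurable.sub_const _).enorm.pow_const 2)).symm
  rw [← volume_cube (cell j x)]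
  refine (enorm_sub_setAverage_sq_le (volume_cube_ne_zero _) (volume_cube_ne_top _)
    (integrableOn_cube f _) _).trans ?_
  rw [htranslate]
  gcongr

theorem lintegral_translate_sub_sq_le (v : H1 N) (z : Space N) :
    ∫⁻ x, ‖fn v (x + z) - fn v x‖ₑ ^ 2 ≤ ENNReal.ofReal (‖z‖ ^ 2 * ‖grad v‖ ^ 2) := by
  rw [← eLpNorm_two_sq, ← mul_pow, ENNReal.ofReal_pow (by positivity)]
  gcongr
  exact eLpNorm_translate_sub_le v z

theorem lintegral_sub_cubeAverage_sq_le (v : H1 N) (j : ℕ) :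
    ∫⁻ x, ‖fn v x - cubeAverage j (fn v) x‖ₑ ^ 2 ≤
      ENNReal.ofReal (2 ^ N * (N * ((2 : ℝ) ^ j)⁻¹ ^ 2 * ‖grad v‖ ^ 2)) := by
  set r : ℝ := ((2 : ℝ) ^ j)⁻¹
  set a := ENNReal.ofReal (r ^ N)
  have ha0 : a ≠ 0 := by rw [ENNReal.ofReal_ne_zero_iff]; positivity
  have hfn : Measurable (fn v) := (Lp.stronglyMeasurable (fn v)).measurable
  have hmeas : Measurable fun q : Space N × Space N ↦ ‖fn v (q.1 + q.2) - fn v q.1‖ₑ ^ 2 :=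
    ((hfn.comp measurable_add).sub (hfn.comp measurable_fst)).enorm.pow_const 2
  calc ∫⁻ x, ‖fn v x - cubeAverage j (fn v) x‖ₑ ^ 2
      ≤ ∫⁻ x, a⁻¹ * ∫⁻ z in box N r, ‖fn v (x + z) - fn v x‖ₑ ^ 2 :=
        lintegral_mono (enorm_sub_cubeAverage_sq_le (fn v) j)
    _ = a⁻¹ * ∫⁻ z in box N r, ∫⁻ x, ‖fn v (x + z) - fn v x‖ₑ ^ 2 := by
        rw [lintegral_const_mul' _ _ (ENNReal.inv_ne_top.2 ha0),
          lintegral_lintegral_swap hmeas.aemeasurable]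
    _ ≤ a⁻¹ * ∫⁻ _z in box N r, ENNReal.ofReal (N * r ^ 2 * ‖grad v‖ ^ 2) := by
        refine mul_le_mul_right (setLIntegral_mono' (measurableSet_box r) fun z hz ↦ ?_) _
        refine (lintegral_translate_sub_sq_le v z).trans ?_
        gcongr
        exact norm_sq_le_of_mem_box hz
    _ = a⁻¹ * a * ENNReal.ofReal (2 ^ N * (N * r ^ 2 * ‖grad v‖ ^ 2)) := by
        rw [setLIntegral_const, volume_box (by positivity), mul_pow,
          ENNReal.ofReal_mul (p := 2 ^ N) (by positivity),
          ENNReal.ofReal_mul (p := 2 ^ N) (by positivity)]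
        ring
    _ = _ := by rw [ENNReal.inv_mul_cancel ha0 ENNReal.ofReal_ne_top, one_mul]

/-- The constant of the Poincaré inequality on dyadic cubes. -/
def poincareConst (N : ℕ) : ℝ := √(2 ^ N * N)

theorem poincareConst_nonneg (N : ℕ) : 0 ≤ poincareConst N := Real.sqrt_nonneg _

theorem eLpNorm_sub_cubeAverage_le (v : H1 N) (j : ℕ) :
    eLpNorm (⇑(fn v) - cubeAverage j (fn v)) 2 volume ≤
      ENNReal.ofReal (poincareConst N * ((2 : ℝ) ^ j)⁻¹ * ‖grad v‖) := by
  have hK := poincareConst_nonneg N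
  rw [← ENNReal.pow_le_pow_left_iff two_ne_zero, eLpNorm_two_sq,
    ← ENNReal.ofReal_pow (by positivity), mul_pow, mul_pow, poincareConst,
    Real.sq_sqrt (by positivity), mul_assoc, mul_assoc (2 ^ N : ℝ), ← mul_assoc (N : ℝ)]
  exact lintegral_sub_cubeAverage_sq_le v j

end Poincare

section Bernstein

variable {N : ℕ} {j : ℕ} {p : ℝ}

/-- The exponent `N (1/2 - 1/p)` of the inequality `‖f‖_p ≤ r^(-N (1/2 - 1/p)) ‖f‖_2` for functions
that are constant on cubes of side `r`; it is less than `1` exactly when `p` is subcritical. -/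
def bernsteinExponent (N : ℕ) (p : ℝ) : ℝ := N * (1 / 2 - 1 / p)

theorem enorm_le_of_eq_on_cubes {f : Space N → ℝ} (hf : ∀ x y, cell j x = cell j y → f x = f y)
    (x : Space N) :
    ‖f x‖ₑ ≤ ENNReal.ofReal (((2 : ℝ) ^ j) ^ N) ^ (1 / 2 : ℝ) * eLpNorm f 2 volume := by
  set Q := cube j (cell j x)
  have hQ : eLpNorm f 2 (volume.restrict Q) = ‖f x‖ₑ * volume Q ^ (1 / 2 : ℝ) := calc
    eLpNorm f 2 (volume.restrict Q) = eLpNorm (fun _ ↦ f x) 2 (volume.restrict Q) := by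
      refine eLpNorm_congr_ae ((ae_restrict_iff' (measurableSet_cube _)).2 (.of_forall ?_))
      exact fun y hy ↦ hf y x hy
    _ = _ := by rw [eLpNorm_const' _ two_ne_zero ENNReal.ofNat_ne_top]; simp
  have hinv : volume Q ^ (1 / 2 : ℝ) = (ENNReal.ofReal (((2 : ℝ) ^ j) ^ N) ^ (1 / 2 : ℝ))⁻¹ := by
    rw [volume_cube, inv_pow, ENNReal.ofReal_inv_of_pos (by positivity), ENNReal.inv_rpow]
  rw [← ENNReal.inv_mul_le_iff (by simp) (by simp), ← hinv, mul_comm, ← hQ]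
  exact eLpNorm_restrict_le f 2 volume Q

theorem eLpNorm_le_of_eq_on_cubes (hp : 2 ≤ p) {f : Space N → ℝ}
    (hfm : AEStronglyMeasurable f volume) (hf : ∀ x y, cell j x = cell j y → f x = f y) :
    eLpNorm f (ENNReal.ofReal p) volume ≤
      ENNReal.ofReal (((2 : ℝ) ^ bernsteinExponent N p) ^ j) * eLpNorm f 2 volume := by
  have hp0 : 0 < p := by linarith
  have hθ : 0 ≤ 1 - 2 / p := by rw [sub_nonneg, div_le_one hp0]; exact hp
  have hsup := eLpNorm_le_rpow_mul_rpow_of_enorm_le hfm two_pos hp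
    (.of_forall (enorm_le_of_eq_on_cubes hf))
  rw [ENNReal.ofReal_ofNat, ENNReal.mul_rpow_of_nonneg _ _ hθ, mul_assoc,
    ← ENNReal.rpow_add_of_nonneg _ _ hθ (by positivity), sub_add_cancel, ENNReal.rpow_one,
    ← ENNReal.rpow_mul, ENNReal.ofReal_rpow_of_nonneg (by positivity) (by positivity)] at hsup
  convert hsup using 3
  rw [← Real.rpow_natCast, ← Real.rpow_natCast, ← Real.rpow_natCast, ← Real.rpow_mul two_pos.le,
    ← Real.rpow_mul two_pos.le, ← Real.rpow_mul two_pos.le, bernsteinExponent]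
  congr 1
  ring

end Bernstein

section Embedding

theorem eLpNorm_sub_le_of_le_geometric {X F : Type*} [MeasurableSpace X] [NormedAddCommGroup F]
    [CompleteSpace F] {μ : Measure X} {q : ENNReal} [Fact (1 ≤ q)] {a : ℕ → X → F} {f : X → F}
    {C r : ENNReal} (hC : C ≠ ⊤) (hr : r < 1) (ha : ∀ n, MemLp (a n) q μ)
    (hstep : ∀ n, eLpNorm (a n - a (n + 1)) q μ ≤ C * r ^ n)
    (hlim : TendstoInMeasure μ a atTop f) (n : ℕ) :
    eLpNorm (f - a n) q μ ≤ C * r ^ n / (1 - r) := by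
  have hstep' (n : ℕ) : edist ((ha n).toLp) ((ha (n + 1)).toLp) ≤ C * r ^ n := by
    rw [Lp.edist_toLp_toLp]
    exact hstep n
  obtain ⟨g, hg⟩ := cauchySeq_tendsto_of_complete (cauchySeq_of_edist_le_geometric r C hr hC hstep')
  have hfg : f =ᵐ[μ] g := tendstoInMeasure_ae_unique hlim
    ((tendstoInMeasure_of_tendsto_Lp hg).congr_left fun n ↦ (ha n).coeFn_toLp)
  calc eLpNorm (f - a n) q μ = edist ((ha n).toLp) g := by
        rw [edist_comm, Lp.edist_def]
        exact eLpNorm_congr_ae (hfg.sub (ha n).coeFn_toLp.symm)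
    _ ≤ C * r ^ n / (1 - r) := edist_le_of_edist_le_geometric_of_tendsto r C hstep' hg n

variable {N : ℕ} {p : ℝ}

theorem norm_sq_eq_add (v : H1 N) : ‖v‖ ^ 2 = ‖fn v‖ ^ 2 + ‖grad v‖ ^ 2 :=
  WithLp.prod_norm_sq_eq_of_L2 v.1

theorem norm_fn_le (v : H1 N) : ‖fn v‖ ≤ ‖v‖ :=
  le_of_sq_le_sq (by rw [norm_sq_eq_add]; exact le_add_of_nonneg_right (by positivity))
    (norm_nonneg v)

theorem norm_grad_le (v : H1 N) : ‖grad v‖ ≤ ‖v‖ :=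
  le_of_sq_le_sq (by rw [norm_sq_eq_add]; exact le_add_of_nonneg_left (by positivity))
    (norm_nonneg v)

theorem aestronglyMeasurable_cubeAverage (j : ℕ) (u : Space N → ℝ) :
    AEStronglyMeasurable (cubeAverage j u) volume :=
  (measurable_cubeAverage j u).aestronglyMeasurable

theorem memLp_cubeAverage (hp : 2 ≤ p) (v : H1 N) (j : ℕ) :
    MemLp (cubeAverage j (fn v)) (ENNReal.ofReal p) volume := by
  have hdiff : MemLp (⇑(fn v) - cubeAverage j (fn v)) 2 volume :=
    ⟨(Lp.aestronglyMeasurable _).sub (aestronglyMeasurable_cubeAverage j _),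
      (eLpNorm_sub_cubeAverage_le v j).trans_lt ENNReal.ofReal_lt_top⟩
  have hL2 : MemLp (cubeAverage j (fn v)) 2 volume := by
    simpa using (Lp.memLp (fn v)).sub hdiff
  exact ⟨hL2.1, (eLpNorm_le_of_eq_on_cubes hp hL2.1 fun _ _ ↦ cubeAverage_eq_of_cell_eq).trans_lt
    (ENNReal.mul_lt_top ENNReal.ofReal_lt_top hL2.2)⟩

theorem eLpNorm_cubeAverage_sub_succ_le (v : H1 N) (j : ℕ) :
    eLpNorm (cubeAverage j (fn v) - cubeAverage (j + 1) (fn v)) 2 volume ≤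
      ENNReal.ofReal (2 * poincareConst N * ((2 : ℝ) ^ j)⁻¹ * ‖grad v‖) := by
  have hK := poincareConst_nonneg N
  have hmeas (j : ℕ) : AEStronglyMeasurable (⇑(fn v) - cubeAverage j (fn v)) volume :=
    (Lp.aestronglyMeasurable _).sub (aestronglyMeasurable_cubeAverage j _)
  rw [← sub_sub_sub_cancel_left _ _ (⇑(fn v)), eLpNorm_sub_comm]
  calc _ ≤ eLpNorm (⇑(fn v) - cubeAverage j (fn v)) 2 volume +
          eLpNorm (⇑(fn v) - cubeAverage (j + 1) (fn v)) 2 volume :=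
        eLpNorm_sub_le (hmeas _) (hmeas _) one_le_two
    _ ≤ ENNReal.ofReal (poincareConst N * ((2 : ℝ) ^ j)⁻¹ * ‖grad v‖) +
          ENNReal.ofReal (poincareConst N * ((2 : ℝ) ^ j)⁻¹ * ‖grad v‖) := by
        gcongr
        · exact eLpNorm_sub_cubeAverage_le v j
        · refine (eLpNorm_sub_cubeAverage_le v (j + 1)).trans ?_
          gcongr
          · exact one_le_two
          · exact j.le_succ
    _ = _ := by
        rw [← ENNReal.ofReal_add (by positivity) (by positivity)]
        ring_nf

/-- The ratio at which dyadic averages converge in `L^p`: passing from generation `j` to `j + 1`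
gains `1/2` by the Poincaré inequality and loses `2 ^ bernsteinExponent N p`. -/
def dyadicRatio (N : ℕ) (p : ℝ) : ℝ := 2 ^ bernsteinExponent N p / 2

theorem dyadicRatio_nonneg (N : ℕ) (p : ℝ) : 0 ≤ dyadicRatio N p := by
  unfold dyadicRatio
  positivity

theorem dyadicRatio_lt_one (hsub : bernsteinExponent N p < 1) : dyadicRatio N p < 1 := by
  rw [dyadicRatio, div_lt_one two_pos]
  exact (Real.rpow_lt_rpow_of_exponent_lt one_lt_two hsub).trans_eq (Real.rpow_one 2)

theorem eLpNorm_cubeAverage_sub_succ_le_geometric (hp : 2 ≤ p) (v : H1 N) (j : ℕ) :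
    eLpNorm (cubeAverage j (fn v) - cubeAverage (j + 1) (fn v)) (ENNReal.ofReal p) volume ≤
      ENNReal.ofReal (4 * poincareConst N * dyadicRatio N p * ‖grad v‖) *
        ENNReal.ofReal (dyadicRatio N p) ^ j := by
  have hK := poincareConst_nonneg N
  have hρ := dyadicRatio_nonneg N p
  have hθ : (2 : ℝ) ^ bernsteinExponent N p = 2 * dyadicRatio N p := by
    rw [dyadicRatio, mul_div_cancel₀ _ two_ne_zero]
  have hconst (x y : Space N) (h : cell (j + 1) x = cell (j + 1) y) :
      (cubeAverage j (fn v) - cubeAverage (j + 1) (fn v)) x =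
        (cubeAverage j (fn v) - cubeAverage (j + 1) (fn v)) y := by
    rw [Pi.sub_apply, Pi.sub_apply, cubeAverage_eq_of_cell_eq h,
      cubeAverage_eq_of_cell_eq (cell_eq_of_cell_succ_eq h)]
  calc _ ≤ ENNReal.ofReal ((2 ^ bernsteinExponent N p) ^ (j + 1)) *
          eLpNorm (cubeAverage j (fn v) - cubeAverage (j + 1) (fn v)) 2 volume :=
        eLpNorm_le_of_eq_on_cubes hp
          ((aestronglyMeasurable_cubeAverage _ _).sub (aestronglyMeasurable_cubeAverage _ _)) hconst
    _ ≤ ENNReal.ofReal ((2 ^ bernsteinExponent N p) ^ (j + 1)) *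
          ENNReal.ofReal (2 * poincareConst N * ((2 : ℝ) ^ j)⁻¹ * ‖grad v‖) := by
        gcongr
        exact eLpNorm_cubeAverage_sub_succ_le v j
    _ = _ := by
        rw [← ENNReal.ofReal_pow hρ, ← ENNReal.ofReal_mul (by positivity),
          ← ENNReal.ofReal_mul (by positivity), hθ, mul_pow]
        congr 1
        field_simp
        ring

theorem tendstoInMeasure_cubeAverage (v : H1 N) :
    TendstoInMeasure volume (fun j ↦ cubeAverage j (fn v)) atTop (fn v) := by
  refine tendstoInMeasure_of_tendsto_eLpNorm two_ne_zero
    (fun j ↦ aestronglyMeasurable_cubeAverage j _) (Lp.aestronglyMeasurable _) ?_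
  have hbound : Tendsto (fun j : ℕ ↦ ENNReal.ofReal (poincareConst N * ((2 : ℝ) ^ j)⁻¹ * ‖grad v‖))
      atTop (𝓝 0) := by
    simpa using ENNReal.tendsto_ofReal (((tendsto_pow_atTop_nhds_zero_of_lt_one
      (r := (2 : ℝ)⁻¹) (by norm_num) (by norm_num)).const_mul (poincareConst N)).mul_const ‖grad v‖)
  refine tendsto_of_tendsto_of_tendsto_of_le_of_le tendsto_const_nhds hbound (fun _ ↦ zero_le)
    fun j ↦ ?_
  rw [eLpNorm_sub_comm]
  exact eLpNorm_sub_cubeAverage_le v j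

variable [Fact (1 ≤ ENNReal.ofReal p)]

theorem exists_eLpNorm_sub_cubeAverage_le (hp : 2 ≤ p) (hsub : bernsteinExponent N p < 1) :
    ∃ C : ℝ, 0 ≤ C ∧ ∀ (v : H1 N) (j : ℕ),
      eLpNorm (⇑(fn v) - cubeAverage j (fn v)) (ENNReal.ofReal p) volume ≤
        ENNReal.ofReal (C * dyadicRatio N p ^ j * ‖grad v‖) := by
  have hK := poincareConst_nonneg N
  have hρ0 := dyadicRatio_nonneg N p
  have hρ1 : 0 < 1 - dyadicRatio N p := sub_pos.2 (dyadicRatio_lt_one hsub)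
  refine ⟨4 * poincareConst N * dyadicRatio N p / (1 - dyadicRatio N p), by positivity,
    fun v j ↦ ?_⟩
  refine (eLpNorm_sub_le_of_le_geometric ENNReal.ofReal_ne_top
    (ENNReal.ofReal_lt_one.2 (dyadicRatio_lt_one hsub)) (memLp_cubeAverage hp v)
    (eLpNorm_cubeAverage_sub_succ_le_geometric hp v) (tendstoInMeasure_cubeAverage v) j).trans_eq ?_
  rw [← ENNReal.ofReal_pow hρ0, ← ENNReal.ofReal_mul (by positivity), ← ENNReal.ofReal_one,
    ← ENNReal.ofReal_sub _ hρ0, ← ENNReal.ofReal_div_of_pos hρ1]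
  ring_nf

theorem exists_eLpNorm_fn_le (hp : 2 ≤ p) (hsub : bernsteinExponent N p < 1) :
    ∃ C : ℝ, 0 ≤ C ∧ ∀ v : H1 N,
      eLpNorm (fn v) (ENNReal.ofReal p) volume ≤ ENNReal.ofReal (C * ‖v‖) := by
  obtain ⟨C, hC, hdiff⟩ := exists_eLpNorm_sub_cubeAverage_le (N := N) hp hsub
  have hK := poincareConst_nonneg N
  refine ⟨C + (1 + poincareConst N), by positivity, fun v ↦ ?_⟩
  have hmeas : AEStronglyMeasurable (cubeAverage 0 (fn v)) volume :=
    aestronglyMeasurable_cubeAverage _ _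
  have hmeas' : AEStronglyMeasurable (⇑(fn v) - cubeAverage 0 (fn v)) volume :=
    (Lp.aestronglyMeasurable _).sub hmeas
  have havg : eLpNorm (cubeAverage 0 (fn v)) (ENNReal.ofReal p) volume ≤
      ENNReal.ofReal ((1 + poincareConst N) * ‖v‖) := by
    calc _ ≤ eLpNorm (cubeAverage 0 (fn v)) 2 volume := by
          simpa using eLpNorm_le_of_eq_on_cubes hp hmeas fun _ _ ↦ cubeAverage_eq_of_cell_eq
      _ = eLpNorm (⇑(fn v) - (⇑(fn v) - cubeAverage 0 (fn v))) 2 volume := by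
          rw [sub_sub_cancel]
      _ ≤ eLpNorm (fn v) 2 volume + eLpNorm (⇑(fn v) - cubeAverage 0 (fn v)) 2 volume :=
          eLpNorm_sub_le (Lp.aestronglyMeasurable _) hmeas' one_le_two
      _ ≤ ENNReal.ofReal ‖v‖ + ENNReal.ofReal (poincareConst N * ‖v‖) := by
          gcongr
          · rw [← Lp.enorm_def, ← ofReal_norm]
            exact ENNReal.ofReal_le_ofReal (norm_fn_le v)
          · refine (eLpNorm_sub_cubeAverage_le v 0).trans ?_
            rw [pow_zero, inv_one, mul_one]
            gcongr
            exact norm_grad_le v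
      _ = _ := by rw [← ENNReal.ofReal_add (by positivity) (by positivity), one_add_mul]
  calc eLpNorm (fn v) (ENNReal.ofReal p) volume
      = eLpNorm ((⇑(fn v) - cubeAverage 0 (fn v)) + cubeAverage 0 (fn v)) (ENNReal.ofReal p)
          volume := by rw [sub_add_cancel]
    _ ≤ ENNReal.ofReal (C * ‖v‖) + ENNReal.ofReal ((1 + poincareConst N) * ‖v‖) := by
        refine (eLpNorm_add_le hmeas' hmeas Fact.out).trans (add_le_add ?_ havg)
        refine (hdiff v 0).trans ?_
        rw [pow_zero, mul_one]
        gcongr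
        exact norm_grad_le v
    _ = _ := by rw [← ENNReal.ofReal_add (by positivity) (by positivity), ← add_mul]

end Embedding

section Hilbert

variable {N : ℕ}

theorem inner_eq_integral (v w : H1 N) :
    inner ℝ v w = ∫ x, (inner ℝ (grad v x) (grad w x) + fn v x * fn w x) := by
  have hinner : inner ℝ v w = inner ℝ (fn v) (fn w) + inner ℝ (grad v) (grad w) :=
    WithLp.prod_inner_apply v.1 w.1
  rw [hinner, add_comm, L2.inner_def, L2.inner_def, ← integral_add (L2.integrable_inner _ _)
    (L2.integrable_inner _ _)]
  simp only [RCLike.inner_apply, conj_trivial, mul_comm]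

theorem memLp_inner_gradient {φ : Space N → ℝ} (hφ : ContDiff ℝ ∞ φ) (hc : HasCompactSupport φ)
    (e : Space N) : MemLp (fun x ↦ inner ℝ (gradient φ x) e) 2 volume :=
  ((continuous_gradient hφ).memLp_of_hasCompactSupport
    (hasCompactSupport_gradient hc)).inner_const e

theorem memLp_smul_const {φ : Space N → ℝ} (hφ : ContDiff ℝ ∞ φ) (hc : HasCompactSupport φ)
    (e : Space N) : MemLp (fun x ↦ φ x • e) 2 volume :=
  (hφ.continuous.smul continuous_const).memLp_of_hasCompactSupport hc.smul_right

theorem inner_integral_smul_gradient (u : Lp ℝ 2 (volume : Measure (Space N)))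
    {φ : Space N → ℝ} (hφ : ContDiff ℝ ∞ φ) (hc : HasCompactSupport φ) (e : Space N) :
    inner ℝ e (∫ x, u x • gradient φ x) = inner ℝ (memLp_inner_gradient hφ hc e).toLp u := by
  rw [← integral_inner (integrable_smul_gradient u hφ hc), L2.inner_def]
  refine integral_congr_ae ?_
  filter_upwards [(memLp_inner_gradient hφ hc e).coeFn_toLp] with x hx
  rw [hx, inner_smul_right, real_inner_comm, RCLike.inner_apply, conj_trivial]

theorem inner_integral_test_smul (g : Lp (Space N) 2 (volume : Measure (Space N)))
    {φ : Space N → ℝ} (hφ : ContDiff ℝ ∞ φ) (hc : HasCompactSupport φ) (e : Space N) :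
    inner ℝ e (∫ x, φ x • g x) = inner ℝ (memLp_smul_const hφ hc e).toLp g := by
  rw [← integral_inner (integrable_test_smul g hφ hc), L2.inner_def]
  refine integral_congr_ae ?_
  filter_upwards [(memLp_smul_const hφ hc e).coeFn_toLp] with x hx
  rw [hx, inner_smul_right, real_inner_smul_left]

theorem isWeakGradient_iff_inner (u : Lp ℝ 2 (volume : Measure (Space N)))
    (g : Lp (Space N) 2 (volume : Measure (Space N))) :
    IsWeakGradient u g ↔ ∀ φ (hφ : ContDiff ℝ ∞ φ) (hc : HasCompactSupport φ) (e : Space N),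
      inner ℝ (memLp_inner_gradient hφ hc e).toLp u =
        -inner ℝ (memLp_smul_const hφ hc e).toLp g := by
  refine forall₃_congr fun φ hφ hc ↦ ?_
  have hcoord (e : Space N) :
      inner ℝ e (∫ x, u x • gradient φ x) = inner ℝ e (-∫ x, φ x • g x) ↔
        inner ℝ (memLp_inner_gradient hφ hc e).toLp u =
          -inner ℝ (memLp_smul_const hφ hc e).toLp g := by
    rw [inner_neg_right, inner_integral_smul_gradient u hφ hc, inner_integral_test_smul g hφ hc]
  simp only [← hcoord]
  exact ⟨fun h e ↦ by rw [h], ext_inner_left ℝ⟩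

theorem isClosed_H1 : IsClosed (H1 N : Set (WithLp 2 (Lp ℝ 2 (volume : Measure (Space N)) ×
    Lp (Space N) 2 (volume : Measure (Space N))))) := by
  change IsClosed {w : WithLp 2 (Lp ℝ 2 (volume : Measure (Space N)) ×
    Lp (Space N) 2 (volume : Measure (Space N))) | IsWeakGradient w.fst w.snd}
  simp only [isWeakGradient_iff_inner, Set.ofPred_forall]
  refine isClosed_iInter fun φ ↦ isClosed_iInter fun hφ ↦ isClosed_iInter fun hc ↦
    isClosed_iInter fun e ↦ isClosed_eq ?_ ?_
  · exact continuous_const.inner (WithLp.prod_continuous_ofLp 2 _ _).fst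
  · exact (continuous_const.inner (WithLp.prod_continuous_ofLp 2 _ _).snd).neg

instance : CompleteSpace (H1 N) := isClosed_H1.completeSpace_coe

end Hilbert

section SobolevEmbedding

variable {N : ℕ} {p : ℝ}

theorem bernsteinExponent_lt_one (hp : 0 < p)
    (hp' : 3 ≤ N → p < 2 * (N : ℝ) / ((N : ℝ) - 2)) : bernsteinExponent N p < 1 := by
  have hsub : (N : ℝ) * (p - 2) < 2 * p := by
    rcases le_or_gt 3 N with h3 | h3
    · have h3' : (3 : ℝ) ≤ N := by exact_mod_cast h3
      have := hp' h3
      rw [lt_div_iff₀ (by linarith)] at this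
      linarith
    · have h2 : (N : ℝ) ≤ 2 := by exact_mod_cast Nat.le_of_lt_succ h3
      nlinarith [mul_nonneg (sub_nonneg.2 h2) hp.le, N.cast_nonneg (α := ℝ)]
  have hexp : bernsteinExponent N p = N * (p - 2) / (2 * p) := by
    rw [bernsteinExponent]
    field_simp
  rwa [hexp, div_lt_one (by positivity)]

variable [Fact (1 ≤ ENNReal.ofReal p)]

theorem memLp_fn (hp : 2 ≤ p) (hsub : bernsteinExponent N p < 1) (v : H1 N) :
    MemLp (fn v) (ENNReal.ofReal p) volume := by
  obtain ⟨C, -, hC⟩ := exists_eLpNorm_fn_le (N := N) hp hsub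
  exact ⟨Lp.aestronglyMeasurable _, (hC v).trans_lt ENNReal.ofReal_lt_top⟩

/-- The inclusion of `H^1(ℝ^N)` into `L^p(B)`, as a linear map. -/
def sobolevInclusion (hp : 2 ≤ p) (hsub : bernsteinExponent N p < 1)
    (B : Set (Space N)) :
    H1 N →ₗ[ℝ] Lp ℝ (ENNReal.ofReal p) ((volume : Measure (Space N)).restrict B) where
  toFun v := ((memLp_fn hp hsub v).restrict B).toLp
  map_add' v w :=
    (MemLp.toLp_congr _ (((memLp_fn hp hsub v).restrict B).add ((memLp_fn hp hsub w).restrict B))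
      (ae_restrict_of_ae (Lp.coeFn_add (fn v) (fn w)))).trans (MemLp.toLp_add _ _)
  map_smul' c v :=
    (MemLp.toLp_congr _ (((memLp_fn hp hsub v).restrict B).const_smul c)
      (ae_restrict_of_ae (Lp.coeFn_smul c (fn v)))).trans (MemLp.toLp_const_smul c _)

theorem exists_norm_sobolevInclusion_le (hp : 2 ≤ p) (hsub : bernsteinExponent N p < 1)
    (B : Set (Space N)) : ∃ C, ∀ v, ‖sobolevInclusion hp hsub B v‖ ≤ C * ‖v‖ := by
  obtain ⟨C, hC, hbound⟩ := exists_eLpNorm_fn_le (N := N) hp hsub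
  refine ⟨C, fun v ↦ (Lp.norm_toLp _ ((memLp_fn hp hsub v).restrict B)).trans_le ?_⟩
  exact ENNReal.toReal_le_of_le_ofReal (by positivity)
    ((eLpNorm_restrict_le _ _ _ _).trans (hbound v))

/-- The Sobolev embedding of `H^1(ℝ^N)` into `L^p(B)`. -/
def sobolevEmbedding (hp : 2 ≤ p) (hsub : bernsteinExponent N p < 1)
    (B : Set (Space N)) :
    H1 N →L[ℝ] Lp ℝ (ENNReal.ofReal p) ((volume : Measure (Space N)).restrict B) :=
  (sobolevInclusion hp hsub B).mkContinuousOfExistsBound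
    (exists_norm_sobolevInclusion_le hp hsub B)

theorem coeFn_sobolevEmbedding (hp : 2 ≤ p) (hsub : bernsteinExponent N p < 1) (B : Set (Space N))
    (v : H1 N) : sobolevEmbedding hp hsub B v =ᵐ[volume.restrict B] fn v :=
  ((memLp_fn hp hsub v).restrict B).coeFn_toLp

theorem disjoint_ker_sobolevEmbedding (hp : 2 ≤ p) (hsub : bernsteinExponent N p < 1)
    (B : Set (Space N)) :
    Disjoint (sobolevEmbedding hp hsub B).ker (sobolevEmbedding hp hsub Bᶜ).ker := by
  have hae (A : Set (Space N)) {v : H1 N} (hv : v ∈ (sobolevEmbedding hp hsub A).ker) :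
      fn v =ᵐ[volume.restrict A] 0 :=
    (coeFn_sobolevEmbedding hp hsub A v).symm.trans
      (by rw [show sobolevEmbedding hp hsub A v = 0 from hv]; exact Lp.coeFn_zero _ _ _)
  refine Submodule.disjoint_def.2 fun v hv hvc ↦ H1.ext_fn (Lp.ext ?_)
  refine EventuallyEq.trans ?_ (Lp.coeFn_zero ℝ 2 _).symm
  exact ae_of_ae_restrict_of_ae_restrict_compl B (hae B hv) (hae Bᶜ hvc)

/-- The inclusion of `H^1(ℝ^N)` into `L^2(ℝ^N)`. -/
def fnCLM (N : ℕ) : H1 N →L[ℝ] Lp ℝ 2 (volume : Measure (Space N)) :=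
  LinearMap.mkContinuous
    { toFun := fn
      map_add' := fun _ _ ↦ rfl
      map_smul' := fun _ _ ↦ rfl } 1 fun v ↦ (norm_fn_le v).trans_eq (one_mul _).symm

/-- Integration over a dyadic cube, as a functional on `H^1(ℝ^N)`. -/
def integralCube (j : ℕ) (k : Fin N → ℤ) : H1 N →L[ℝ] ℝ :=
  (innerSL ℝ (indicatorConstLp 2 (measurableSet_cube k) (volume_cube_ne_top (j := j) k)
    (1 : ℝ))).comp (fnCLM N)

theorem integralCube_apply (j : ℕ) (k : Fin N → ℤ) (v : H1 N) :
    integralCube j k v = ∫ x in cube j k, fn v x :=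
  L2.inner_indicatorConstLp_one (measurableSet_cube k) (volume_cube_ne_top (j := j) k) (fn v)

theorem exists_forall_ker_cubeAverage_eq_zero {B : Set (Space N)} (hB : Bornology.IsBounded B)
    (j : ℕ) : ∃ (n : ℕ) (R : H1 N →L[ℝ] Fin n → ℝ),
      ∀ v, R v = 0 → ∀ x ∈ B, cubeAverage j (fn v) x = 0 := by
  have hfin := finite_cell_image hB j
  let e := hfin.toFinset.equivFin
  refine ⟨_, ContinuousLinearMap.pi fun i ↦ integralCube j (e.symm i), fun v hv x hx ↦ ?_⟩
  have hcell : cell j x ∈ hfin.toFinset := hfin.mem_toFinset.2 (Set.mem_image_of_mem _ hx)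
  have hzero : integralCube j (e.symm (e ⟨_, hcell⟩)) v = 0 := congrFun hv _
  rw [e.symm_apply_apply, integralCube_apply] at hzero
  rw [cubeAverage, setAverage_eq, hzero, smul_zero]

theorem exists_forall_ker_eLpNorm_fn_le (hp : 2 ≤ p) (hsub : bernsteinExponent N p < 1)
    {B : Set (Space N)} (hBm : MeasurableSet B) (hB : Bornology.IsBounded B) {δ : ℝ} (hδ : 0 < δ) :
    ∃ (n : ℕ) (R : H1 N →L[ℝ] Fin n → ℝ), ∀ v, R v = 0 →
      eLpNorm (fn v) (ENNReal.ofReal p) (volume.restrict B) ≤ ENNReal.ofReal (δ * ‖v‖) := by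
  obtain ⟨C, _, hbound⟩ := exists_eLpNorm_sub_cubeAverage_le (N := N) hp hsub
  have hρ := dyadicRatio_nonneg N p
  have hlim : Tendsto (fun j ↦ C * dyadicRatio N p ^ j) atTop (𝓝 0) := by
    simpa using (tendsto_pow_atTop_nhds_zero_of_lt_one hρ (dyadicRatio_lt_one hsub)).const_mul C
  obtain ⟨j, hj⟩ := (hlim.eventually_le_const hδ).exists
  obtain ⟨n, R, hR⟩ := exists_forall_ker_cubeAverage_eq_zero hB j
  refine ⟨n, R, fun v hv ↦ ?_⟩
  calc eLpNorm (fn v) (ENNReal.ofReal p) (volume.restrict B)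
      = eLpNorm (⇑(fn v) - cubeAverage j (fn v)) (ENNReal.ofReal p) (volume.restrict B) := by
        refine eLpNorm_congr_ae ?_
        filter_upwards [ae_restrict_mem hBm] with x hx
        rw [Pi.sub_apply, hR v hv x hx, sub_zero]
    _ ≤ ENNReal.ofReal (C * dyadicRatio N p ^ j * ‖grad v‖) :=
        (eLpNorm_restrict_le _ _ _ _).trans (hbound v j)
    _ ≤ ENNReal.ofReal (δ * ‖v‖) := by
        gcongr
        exact norm_grad_le v

theorem isCompactOperator_sobolevEmbedding (hp : 2 ≤ p) (hsub : bernsteinExponent N p < 1)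
    {B : Set (Space N)} (hBm : MeasurableSet B) (hB : Bornology.IsBounded B) :
    IsCompactOperator (sobolevEmbedding hp hsub B) := by
  refine isCompactOperator_of_forall_ker_norm_le fun δ hδ ↦
    (exists_forall_ker_eLpNorm_fn_le hp hsub hBm hB hδ).imp fun n ↦ Exists.imp fun R hR v hv ↦ ?_
  refine (Lp.norm_toLp _ ((memLp_fn hp hsub v).restrict B)).trans_le ?_
  exact ENNReal.toReal_le_of_le_ofReal (by positivity) (hR v hv)

end SobolevEmbedding

/-! ### Bump functions in the Sobolev space -/

section TestFunctions

variable {N : ℕ}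

theorem isWeakGradient_gradient {φ : Space N → ℝ} (hφ : ContDiff ℝ ∞ φ) :
    IsWeakGradient φ (gradient φ) := by
  intro ψ hψ hψc
  have hint : Integrable (fun x ↦ φ x • gradient ψ x) :=
    (hφ.continuous.smul (continuous_gradient hψ)).integrable_of_hasCompactSupport
      (hasCompactSupport_gradient hψc).smul_left
  have hint' : Integrable (fun x ↦ ψ x • gradient φ x) :=
    (hψ.continuous.smul (continuous_gradient hφ)).integrable_of_hasCompactSupport hψc.smul_right
  have hint_mul : Integrable (fun x ↦ φ x * ψ x) :=
    (hφ.continuous.mul hψ.continuous).integrable_of_hasCompactSupport hψc.mul_left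
  have hinner (u v : Space N → ℝ) (e x : Space N) :
      inner ℝ e (u x • gradient v x) = u x * fderiv ℝ v x e := by
    rw [inner_smul_right, real_inner_comm, gradient, InnerProductSpace.toDual_symm_apply]
  refine ext_inner_left ℝ fun e ↦ ?_
  have hinte := hint.const_inner (𝕜 := ℝ) e
  have hinte' := hint'.const_inner (𝕜 := ℝ) e
  rw [inner_neg_right, ← integral_inner hint, ← integral_inner hint']
  simp only [hinner, mul_comm (ψ _)] at hinte hinte' ⊢
  exact integral_mul_fderiv_eq_neg_fderiv_mul_of_integrable hinte' hinte hint_mul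
    (fun x _ ↦ hφ.differentiable (by simp) x) (fun x _ ↦ hψ.differentiable (by simp) x)

theorem IsWeakGradient.congr_ae {u u' : Space N → ℝ} {g g' : Space N → Space N}
    (h : IsWeakGradient u g) (hu : u =ᵐ[volume] u') (hg : g =ᵐ[volume] g') :
    IsWeakGradient u' g' := by
  intro φ hφ hφc
  have hfn : ∫ x, u' x • gradient φ x = ∫ x, u x • gradient φ x :=
    integral_congr_ae (hu.mono fun x hx ↦ by simp only [hx])
  have hgrad : ∫ x, φ x • g' x = ∫ x, φ x • g x :=
    integral_congr_ae (hg.mono fun x hx ↦ by simp only [hx])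
  rw [hfn, hgrad, h φ hφ hφc]

/-- A test function, as an element of `H^1(ℝ^N)`. -/
def ofTest {φ : Space N → ℝ} (hφ : ContDiff ℝ ∞ φ) (hφc : HasCompactSupport φ) :
    H1 N :=
  have hφ2 : MemLp φ 2 volume := hφ.continuous.memLp_of_hasCompactSupport hφc
  have hgrad2 : MemLp (gradient φ) 2 volume :=
    (continuous_gradient hφ).memLp_of_hasCompactSupport (hasCompactSupport_gradient hφc)
  ⟨WithLp.toLp 2 (hφ2.toLp φ, hgrad2.toLp (gradient φ)),
    (isWeakGradient_gradient hφ).congr_ae hφ2.coeFn_toLp.symm hgrad2.coeFn_toLp.symm⟩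

theorem fn_ofTest {φ : Space N → ℝ} (hφ : ContDiff ℝ ∞ φ) (hφc : HasCompactSupport φ) :
    fn (ofTest hφ hφc) =ᵐ[volume] φ :=
  (hφ.continuous.memLp_of_hasCompactSupport hφc).coeFn_toLp

theorem fn_ofTest_ne_zero {φ : Space N → ℝ} (hφ : ContDiff ℝ ∞ φ) (hφc : HasCompactSupport φ)
    (hne : φ ≠ 0) : fn (ofTest hφ hφc) ≠ 0 := by
  intro h
  have hae : φ =ᵐ[volume] 0 := (fn_ofTest hφ hφc).symm.trans (h ▸ Lp.coeFn_zero ℝ 2 volume)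
  exact hne ((hφ.continuous.ae_eq_iff_eq volume continuous_const).1 hae)

theorem inner_fn_ofTest_eq_zero {φ ψ : Space N → ℝ} (hφ : ContDiff ℝ ∞ φ)
    (hφc : HasCompactSupport φ) (hψ : ContDiff ℝ ∞ ψ) (hψc : HasCompactSupport ψ)
    (hdisj : Disjoint (Function.support φ) (Function.support ψ)) :
    inner ℝ (fn (ofTest hφ hφc)) (fn (ofTest hψ hψc)) = 0 := by
  rw [L2.inner_def]
  refine integral_eq_zero_of_ae ?_
  filter_upwards [fn_ofTest hφ hφc, fn_ofTest hψ hψc] with x hxφ hxψ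
  have hzero : φ x = 0 ∨ ψ x = 0 := by
    by_contra! h
    exact Set.disjoint_left.1 hdisj h.1 h.2
  rw [hxφ, hxψ, RCLike.inner_apply, conj_trivial]
  exact mul_eq_zero.2 hzero.symm

theorem exists_contDiff_pairwise_disjoint_support {E : Type*} [NormedAddCommGroup E]
    [NormedSpace ℝ E] [FiniteDimensional ℝ E] [Nontrivial E] {B : Set E} (hB : IsOpen B)
    (hne : B.Nonempty) :
    ∃ f : ℕ → E → ℝ, (∀ n, ContDiff ℝ ∞ (f n)) ∧ (∀ n, f n ≠ 0) ∧
      (∀ n, Function.support (f n) ⊆ B) ∧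
      Pairwise (Function.onFun Disjoint fun n ↦ Function.support (f n)) := by
  obtain ⟨x, hx⟩ := hne
  have : Infinite B := (infinite_of_mem_nhds x (hB.mem_nhds hx)).to_subtype
  obtain ⟨U, hUinf, hUo, hUdisj⟩ := exists_seq_infinite_isOpen_pairwise_disjoint B
  choose f hsupp hf _ using fun n ↦
    (hB.isOpenMap_subtype_val _ (hUo n)).exists_contDiff_support_eq (n := ⊤)
  refine ⟨f, hf, fun n ↦ ?_, fun n ↦ ?_, fun m n hmn ↦ ?_⟩
  · rw [← Function.support_nonempty_iff, hsupp]
    exact (hUinf n).nonempty.image _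
  · rw [hsupp]
    exact Subtype.coe_image_subset B _
  · rw [Function.onFun, hsupp, hsupp, Set.disjoint_image_iff Subtype.val_injective]
    exact hUdisj hmn

theorem not_finiteDimensional_of_forall_ofTest_mem [NeZero N] {B : Set (Space N)} (hBo : IsOpen B)
    (hBb : Bornology.IsBounded B) (hBne : B.Nonempty) {K : Submodule ℝ (H1 N)}
    (hK : ∀ (φ : Space N → ℝ) (hφ : ContDiff ℝ ∞ φ) (hφc : HasCompactSupport φ),
      Function.support φ ⊆ B → ofTest hφ hφc ∈ K) : ¬FiniteDimensional ℝ K := by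
  intro _
  obtain ⟨f, hf, hfne, hfB, hfdisj⟩ := exists_contDiff_pairwise_disjoint_support hBo hBne
  have hfc (n : ℕ) : HasCompactSupport (f n) :=
    .of_support_subset_isCompact hBb.isCompact_closure ((hfB n).trans subset_closure)
  let c (n : ℕ) : K := ⟨ofTest (hf n) (hfc n), hK _ _ _ (hfB n)⟩
  have hindep : LinearIndependent ℝ (((fnCLM N).toLinearMap ∘ₗ K.subtype) ∘ c) :=
    linearIndependent_of_ne_zero_of_inner_eq_zero
      (fun n ↦ fn_ofTest_ne_zero (hf n) (hfc n) (hfne n))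
      fun m n hmn ↦ inner_fn_ofTest_eq_zero (hf m) (hfc m) (hf n) (hfc n) (hfdisj hmn)
  exact not_finite_iff_infinite.2 inferInstance (LinearIndependent.of_comp _ hindep).finite

theorem not_finiteDimensional_ker_sobolevEmbedding_compl [NeZero N] {p : ℝ}
    [Fact (1 ≤ ENNReal.ofReal p)] (hp : 2 ≤ p) (hsub : bernsteinExponent N p < 1)
    {B : Set (Space N)} (hBo : IsOpen B) (hBb : Bornology.IsBounded B) (hBne : B.Nonempty) :
    ¬FiniteDimensional ℝ (sobolevEmbedding hp hsub Bᶜ).ker := by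
  refine not_finiteDimensional_of_forall_ofTest_mem hBo hBb hBne fun φ hφ hφc hφB ↦ ?_
  refine LinearMap.mem_ker.2 (Lp.ext ?_)
  refine (coeFn_sobolevEmbedding hp hsub Bᶜ _).trans (.trans ?_ (Lp.coeFn_zero ℝ _ _).symm)
  filter_upwards [ae_restrict_of_ae (fn_ofTest hφ hφc), ae_restrict_mem hBo.measurableSet.compl]
    with x hx hxB
  rw [hx]
  exact Function.notMem_support.1 fun h ↦ hxB (hφB h)

end TestFunctions

section Solutions

open scoped Pointwise

variable {N : ℕ} {Ω : Set (Space N)} {ε p : ℝ}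

theorem Qeps_of_mem (hε : ε ≠ 0) {x : Space N} (hx : x ∈ ε • Ω) : Qeps Ω ε x = 1 :=
  if_pos ((Set.mem_smul_set_iff_inv_smul_mem₀ hε Ω x).1 hx)

theorem Qeps_of_notMem (hε : ε ≠ 0) {x : Space N} (hx : x ∉ ε • Ω) : Qeps Ω ε x = -1 :=
  if_neg (mt (Set.mem_smul_set_iff_inv_smul_mem₀ hε Ω x).2 hx)

theorem integrable_and_integral_Qeps_mul (hε : ε ≠ 0) (hΩ : MeasurableSet (ε • Ω))
    {F : Space N → ℝ} (hF : IntegrableOn F (ε • Ω)) (hF' : IntegrableOn F (ε • Ω)ᶜ) :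
    Integrable (fun x ↦ Qeps Ω ε x * F x) ∧
      ∫ x, Qeps Ω ε x * F x = (∫ x in ε • Ω, F x) - ∫ x in (ε • Ω)ᶜ, F x := by
  have hin : Set.EqOn (fun x ↦ Qeps Ω ε x * F x) F (ε • Ω) := fun x hx ↦ by
    simp only [Qeps_of_mem hε hx, one_mul]
  have hout : Set.EqOn (fun x ↦ Qeps Ω ε x * F x) (-F) (ε • Ω)ᶜ := fun x hx ↦ by
    simp only [Qeps_of_notMem hε hx, neg_one_mul, Pi.neg_apply]
  have hint : Integrable (fun x ↦ Qeps Ω ε x * F x) := by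
    rw [← integrableOn_univ, ← Set.union_compl_self (ε • Ω)]
    exact (hF.congr_fun hin.symm hΩ).union (hF'.neg.congr_fun hout.symm hΩ.compl)
  refine ⟨hint, ?_⟩
  rw [← integral_add_compl hΩ hint, setIntegral_congr_fun hΩ hin,
    setIntegral_congr_fun hΩ.compl hout, sub_eq_add_neg]
  exact congrArg _ (integral_neg F)

variable [Fact (1 ≤ ENNReal.ofReal p)]

theorem sobolevEmbedding_abs_rpow_mul_ae_eq (hp : 2 ≤ p) (hsub : bernsteinExponent N p < 1)
    (B : Set (Space N)) (v w : H1 N) :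
    (fun x ↦ |sobolevEmbedding hp hsub B v x| ^ (p - 2) * sobolevEmbedding hp hsub B v x *
      sobolevEmbedding hp hsub B w x) =ᵐ[volume.restrict B]
        fun x ↦ |fn v x| ^ (p - 2) * fn v x * fn w x := by
  filter_upwards [coeFn_sobolevEmbedding hp hsub B v, coeFn_sobolevEmbedding hp hsub B w]
    with x hv hw
  rw [hv, hw]

theorem integrableOn_abs_rpow_mul_fn_mul_fn (hp : 2 ≤ p) (hsub : bernsteinExponent N p < 1)
    (B : Set (Space N)) (v w : H1 N) :
    IntegrableOn (fun x ↦ |fn v x| ^ (p - 2) * fn v x * fn w x) B :=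
  (integrable_abs_rpow_mul_mul hp _ _ _).congr (sobolevEmbedding_abs_rpow_mul_ae_eq hp hsub B v w)

theorem dualPower_sobolevEmbedding (hp : 2 ≤ p) (hsub : bernsteinExponent N p < 1)
    (B : Set (Space N)) (v w : H1 N) :
    dualPower hp (sobolevEmbedding hp hsub B v) (sobolevEmbedding hp hsub B w) =
      ∫ x in B, |fn v x| ^ (p - 2) * fn v x * fn w x :=
  integral_congr_ae (sobolevEmbedding_abs_rpow_mul_ae_eq hp hsub B v w)

theorem isSolution_of_inner_eq (hp : 2 ≤ p) (hsub : bernsteinExponent N p < 1) (hε : ε ≠ 0)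
    (hΩ : MeasurableSet (ε • Ω)) {v : H1 N}
    (hv : ∀ w, inner ℝ v w =
      dualPower hp (sobolevEmbedding hp hsub (ε • Ω) v) (sobolevEmbedding hp hsub (ε • Ω) w) -
      dualPower hp (sobolevEmbedding hp hsub (ε • Ω)ᶜ v) (sobolevEmbedding hp hsub (ε • Ω)ᶜ w)) :
    IsSolution Ω ε p v := by
  intro w
  obtain ⟨hint, hsplit⟩ := integrable_and_integral_Qeps_mul hε hΩ
    (integrableOn_abs_rpow_mul_fn_mul_fn hp hsub _ v w)
    (integrableOn_abs_rpow_mul_fn_mul_fn hp hsub _ v w)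
  simp only [← mul_assoc] at hint hsplit
  refine ⟨hint, ?_⟩
  rw [← inner_eq_integral, hv, dualPower_sobolevEmbedding, dualPower_sobolevEmbedding, hsplit]

theorem exists_le_norm_isSolution [NeZero N] (hΩo : IsOpen Ω) (hΩb : Bornology.IsBounded Ω)
    (hΩne : Ω.Nonempty) (hp : 2 < p) (hsub : bernsteinExponent N p < 1) (hε : ε ≠ 0) (r : ℝ) :
    ∃ v : H1 N, r ≤ ‖v‖ ∧ IsSolution Ω ε p v := by
  have hBo : IsOpen (ε • Ω) := hΩo.smul₀ hε
  have hBb : Bornology.IsBounded (ε • Ω) := hΩb.smul₀ ε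
  exact (exists_le_norm_inner_eq_sub (isDualityMap_dualPower hp.le)
    (isDualityMap_dualPower hp.le) hp
    (isCompactOperator_sobolevEmbedding hp.le hsub hBo.measurableSet hBb)
    (not_finiteDimensional_ker_sobolevEmbedding_compl hp.le hsub hBo hBb hΩne.smul_set)
    (disjoint_ker_sobolevEmbedding hp.le hsub _) r).imp fun v hv ↦
      ⟨hv.1, isSolution_of_inner_eq hp.le hsub hε hBo.measurableSet hv.2⟩

end Solutions

end SelfFocusing

end

theorem theorem1p1 (N : ℕ) (hN : 1 ≤ N)
    (Ω : Set (SelfFocusing.Space N)) (hΩo : IsOpen Ω) (hΩb : Bornology.IsBounded Ω)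
    (hΩne : Ω.Nonempty)
    (p : ℝ) (hp : 2 < p) (hp' : 3 ≤ N → p < 2 * (N : ℝ) / ((N : ℝ) - 2))
    (ε : ℝ) (hε : 0 < ε) :
    {v : SelfFocusing.H1 N | SelfFocusing.IsSolution Ω ε p v}.Infinite ∧
    ∃ v : ℕ → SelfFocusing.H1 N,
      (∀ k, SelfFocusing.IsSolution Ω ε p (v k)) ∧
      ¬ Bornology.IsBounded (Set.range v) := by
  have : NeZero N := ⟨Nat.one_le_iff_ne_zero.1 hN⟩
  have : Fact (1 ≤ ENNReal.ofReal p) := ⟨ENNReal.one_le_ofReal.2 (by linarith)⟩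
  have hsub := SelfFocusing.bernsteinExponent_lt_one (by linarith) hp'
  choose v hv hsol using fun k : ℕ ↦
    SelfFocusing.exists_le_norm_isSolution hΩo hΩb hΩne hp hsub hε.ne' k
  have hunbdd : ¬ Bornology.IsBounded (Set.range v) := by
    intro hbdd
    obtain ⟨C, hC⟩ := hbdd.exists_norm_le
    obtain ⟨k, hk⟩ := exists_nat_gt C
    exact (hk.trans_le (hv k)).not_ge (hC _ (Set.mem_range_self k))
  exact ⟨fun hfin ↦ hunbdd (hfin.isBounded.subset (Set.range_subset_iff.2 hsol)), v, hsol, hunbdd⟩
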